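/- A \emph{nice Lie algebra} is a pair $(\mathfrak g,\mathcal B)$ of a real Lie algebra $\mathfrak g$ and a basis $\mathcal B=\{e_1,\dots,e_n\}$, with dual basis $e^1,\dots,e^n$, such that each $[e_i,e_j]$ is a multiple of some $e_k$ and each interior product $e_i\lrcorner de^j$ is a multiple of some $e^k$, where $de^j(x,y)=-e^j([x,y])$. It is \emph{irreducible} if $\mathcal B$ is not a disjoint union of two nonempty subsets each spanning an ideal. Two nice Lie algebras are \emph{equivalent} if there is a Lie algebra isomorphism mapping each element of the first basis to a nonzero multiple of an element of the second. The \emph{diagonal Nikolayevsky derivation} $N$ of a nice nilpotent Lie algebra is its derivation that is diagonal with respect to $\mathcal B$ and satisfies $\operatorname{Tr}(NX)=\operatorname{Tr}X$ for all derivations $X$ of $\mathfrak g$. Let $\mathbf S$ be the set of signatures of the diagonal metrics $g=g_1e^1\otimes e^1+\dots+g_ne^n\otimes e^n$ (all $g_i\in\mathbb R\setminus\{0\}$) whose Ricci operator satisfies $$\operatorname{Ric}=-\tfrac12\operatorname{id}+\tfrac12N,\qquad N\neq0,$$ where the signature of $g$ is the set of indices $i$ with $g_i<0$, written as a string of digits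 (e.g. $13$ for $\{1,3\}$). \textbf{Theorem.} Every irreducible nice nilpotent Lie algebra of dimension $n$ with $2\le n\le 6$ is equivalent to one in the following table. Conversely, each row of the table defines an irreducible nice nilpotent Lie algebra, and for every nice Lie algebra equivalent to it, $N$ and $\mathbf S$ are those given in the row, up to the relabelling of the basis given by the equivalence. The second column lists $(de^1,\dots,de^n)$, with $e^{ij}=e^i\wedge e^j$; the third lists the diagonal entries of $N$. \begin{tabular}{llll} Name & $\mathfrak g$ & $N$ & $\mathbf S$ \\ \texttt{31:1} & $0,0,e^{12}$ & $\tfrac{2}{3}(1,1,2)$ & $\{\emptyset,12,13,23\}$ \\ \texttt{421:1} & $0,0,e^{12},e^{13}$ & $\tfrac{1}{3}(1,2,3,4)$ & $\{\emptyset,124,13,234\}$ \\ \texttt{5321:1} & $0,0,e^{12},e^{13},e^{14}$ & $\tfrac{1}{12}(2,9,11,13,15)$ & $\{\emptyset,124,135,2345\}$ \\ \texttt{5321:2} & $0,0,e^{12},e^{13},e^{14}+e^{23}$ & $\tfrac{3}{11}(1,2,3,4,5)$ & $\{\emptyset,135\}$ \\ \texttt{532:1} & $0,0,e^{12},e^{13},e^{23}$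 & $\tfrac{5}{12}(1,1,2,3,3)$ & $\{\emptyset,1245,135,234\}$ \\ \texttt{521:2} & $0,0,0,e^{12},e^{24}+e^{13}$ & $\tfrac{1}{7}(4,3,6,7,10)$ & $\{\emptyset,125,145,24\}$ \\ \texttt{52:1} & $0,0,0,e^{12},e^{13}$ & $\tfrac{1}{4}(2,3,3,5,5)$ & $\{\emptyset,123,125,134,145,2345,24,35\}$ \\ \texttt{51:2} & $0,0,0,0,e^{12}+e^{34}$ & $\tfrac{3}{4}(1,1,1,1,2)$ & $\{\emptyset,12,1234,135,145,235,245,34\}$ \\ \texttt{64321:1} & $0,0,e^{12},e^{13},e^{14},e^{15}$ & $\tfrac{1}{11}(1,9,10,11,12,13)$ & $\{\emptyset,1246,135,23456\}$ \\ \texttt{64321:2} & $0,0,e^{12},e^{13},e^{14},e^{15}+e^{23}$ & $\tfrac{13}{68}(1,3,4,5,6,7)$ & $\{\emptyset,1246\}$ \\ \texttt{64321:3} & $0,0,-e^{12},e^{13},e^{14},e^{34}+e^{25}$ & $\tfrac{1}{6}(1,3,4,5,6,9)$ & $\{\emptyset,1246,1356,2345\}$ \\ \texttt{64321:4} & $0,0,e^{12},e^{13},e^{23}+e^{14},e^{24}+e^{15}$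 & $\tfrac{3}{13}(1,2,3,4,5,6)$ & $\{\emptyset,135\}$ \\ \texttt{64321:5} & $0,0,-e^{12},e^{13},e^{23}+e^{14},e^{34}+e^{25}$ & $\tfrac{11}{52}(1,2,3,4,5,7)$ & $\{\emptyset,1356\}$ \\ \texttt{6431:1} & $0,0,e^{12},e^{13},e^{23},e^{14}$ & $\tfrac{1}{4}(1,2,3,4,5,5)$ & $\{\emptyset,1245,1356,2346\}$ \\ \texttt{6431:2a} & $0,0,e^{12},e^{13},e^{23},e^{14}+e^{25}$ & $\tfrac{7}{20}(1,1,2,3,3,4)$ & $\{\emptyset,1245,1356,2346\}$ \\ \texttt{6431:2b} & $0,0,e^{12},-e^{13},e^{23},e^{14}+e^{25}$ & $\tfrac{7}{20}(1,1,2,3,3,4)$ & $\{\emptyset,1245,1356,2346\}$ \\ \texttt{6431:3} & $0,0,e^{12},e^{13},e^{23},e^{24}+e^{15}$ & $\tfrac{7}{20}(1,1,2,3,3,4)$ & $\{\emptyset,1245,135,234\}$ \\ \texttt{6321:2} & $0,0,0,e^{12},e^{14},e^{15}+e^{23}$ & $\tfrac{1}{15}(4,9,12,13,17,21)$ & $\{\emptyset,1235,1346,2456\}$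 \\ \texttt{6321:4} & $0,0,0,-e^{12},e^{14}+e^{23},e^{15}+e^{34}$ & $\tfrac{1}{20}(6,11,12,17,23,29)$ & $\{\emptyset,125,146,2456\}$ \\ \texttt{632:2} & $0,0,0,e^{12},e^{14},e^{24}+e^{13}$ & $\tfrac{1}{13}(5,6,12,11,16,17)$ & $\{\emptyset,1256,146,245\}$ \\ \texttt{632:3a} & $0,0,0,e^{12},e^{23}+e^{14},e^{13}+e^{24}$ & $\tfrac{3}{7}(1,1,2,2,3,3)$ & $\{\emptyset,1256,146,245\}$ \\ \texttt{632:3b} & $0,0,0,e^{12},e^{23}-e^{14},e^{24}+e^{13}$ & $\tfrac{3}{7}(1,1,2,2,3,3)$ & $\{\emptyset,1256,146,245\}$ \\ \texttt{631:1} & $0,0,0,e^{12},e^{13},e^{14}$ & $\tfrac{1}{7}(2,5,6,7,8,9)$ & $\{\emptyset,1236,1256,134,145,23456,246,35\}$ \\ \texttt{631:2} & $0,0,0,e^{12},e^{13},e^{24}$ & $\tfrac{1}{12}(6,5,9,11,15,16)$ & $\{\emptyset,1236,1256,1346,1456,2345,24,35\}$ \\ \texttt{631:3} & $0,0,0,e^{12},e^{13},e^{23}+e^{14}$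 & $\tfrac{1}{8}(3,5,6,8,9,11)$ & $\{\emptyset,1256,145,246\}$ \\ \texttt{631:4} & $0,0,0,e^{12},e^{13},e^{24}+e^{15}$ & $\tfrac{2}{11}(2,3,4,5,6,8)$ & $\{\emptyset,1236,1346,24\}$ \\ \texttt{631:5a} & $0,0,0,e^{12},e^{13},e^{35}+e^{24}$ & $\tfrac{1}{2}(1,1,1,2,2,3)$ & $\{\emptyset,1236,1256,1346,1456,2345,24,35\}$ \\ \texttt{631:5b} & $0,0,0,-e^{12},e^{13},e^{24}+e^{35}$ & $\tfrac{1}{2}(1,1,1,2,2,3)$ & $\{\emptyset,1236,1256,1346,1456,2345,24,35\}$ \\ \texttt{631:6} & $0,0,0,e^{12},e^{13},e^{34}+e^{25}$ & $\tfrac{1}{2}(1,1,1,2,2,3)$ & $\{\emptyset,1236,125,134,1456,2345,246,356\}$ \\ \texttt{63:1} & $0,0,0,e^{12},e^{13},e^{23}$ & $\tfrac{3}{5}(1,1,1,2,2,2)$ & $\{\emptyset,123,1256,1346,145,2345,246,356\}$ \\ \texttt{621:3} & $0,0,0,0,e^{12},e^{15}+e^{34}$ & $\tfrac{1}{12}(5,8,9,9,13,18)$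 & $\{\emptyset,1236,1246,1345,15,2356,2456,34\}$ \\ \texttt{62:3} & $0,0,0,0,e^{12},e^{13}+e^{24}$ & $\tfrac{1}{5}(3,3,4,4,6,7)$ & $\{\emptyset,1234,126,135,1456,2356,245,346\}$ \\ \texttt{62:4a} & $0,0,0,0,e^{13}+e^{24},e^{34}+e^{12}$ & $\tfrac{2}{3}(1,1,1,1,2,2)$ & $\{\emptyset,1234,125,136,1456,2356,246,345\}$ \\ \texttt{62:4b} & $0,0,0,0,e^{24}-e^{13},e^{34}+e^{12}$ & $\tfrac{2}{3}(1,1,1,1,2,2)$ & $\{\emptyset,1234,125,136,1456,2356,246,345\}$ \\ \end{tabular} -/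

import Mathlib

open Module

namespace NiceNilsoliton

/-! ### Ricci operator of a left-invariant pseudo-Riemannian metric -/

section Geometry

variable {L : Type*} [LieRing L] [LieAlgebra ℝ L]

/-- `D` is the Levi-Civita connection, restricted to left-invariant vector fields, of the
left-invariant metric `B`: it is torsion-free and compatible with the metric. -/
structure IsLeviCivita (B : LinearMap.BilinForm ℝ L) (D : L →ₗ[ℝ] L →ₗ[ℝ] L) : Prop where
  torsionFree : ∀ x y, D x y - D y x = ⁅x, y⁆
  metric : ∀ x y z, B (D x y) z + B y (D x z) = 0

/-- The endomorphism `x ↦ R(x, y) z`, with `R(x, y) = D_x D_y - D_y D_x - D_[x, y]`. -/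
def curvature (D : L →ₗ[ℝ] L →ₗ[ℝ] L) (y z : L) : L →ₗ[ℝ] L where
  toFun x := D x (D y z) - D y (D x z) - D ⁅x, y⁆ z
  map_add' x x' := by
    simp only [map_add, LinearMap.add_apply, add_lie]
    abel
  map_smul' a x := by
    simp only [map_smul, LinearMap.smul_apply, smul_lie, RingHom.id_apply, smul_sub]

/-- The Ricci tensor `ric(y, z) = tr (x ↦ R(x, y) z)`. -/
noncomputable def ricciTensor (D : L →ₗ[ℝ] L →ₗ[ℝ] L) (y z : L) : ℝ :=
  LinearMap.trace ℝ L (curvature D y z)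

/-- `R` is the Ricci operator of the metric `B`: `B (R y) z = ric(y, z)`. -/
def IsRicciOperator (B : LinearMap.BilinForm ℝ L) (R : Module.End ℝ L) : Prop :=
  ∃ D : L →ₗ[ℝ] L →ₗ[ℝ] L, IsLeviCivita B D ∧ ∀ y z, B (R y) z = ricciTensor D y z

end Geometry

/-! ### Nice Lie algebras -/

section Nice

variable {L : Type*} [LieRing L] [LieAlgebra ℝ L] {n : ℕ}

/-- The interior product `e_i ⌟ de^j`, where `de^j (x, y) = - e^j [x, y]`. -/
noncomputable def interiorDiff (b : Basis (Fin n) ℝ L) (i j : Fin n) : L →ₗ[ℝ] ℝ :=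
  -((b.coord j) ∘ₗ (LieAlgebra.ad ℝ L (b i) : L →ₗ[ℝ] L))

/-- A nice basis: each bracket `[e_i, e_j]` is a multiple of some `e_k`, and each interior
product `e_i ⌟ de^j` is a multiple of some `e^k`. -/
structure IsNice (b : Basis (Fin n) ℝ L) : Prop where
  bracket : ∀ i j, ∃ (k : Fin n) (c : ℝ), ⁅b i, b j⁆ = c • b k
  interior : ∀ i j, ∃ (k : Fin n) (c : ℝ), interiorDiff b i j = c • b.coord k

/-- The basis elements with index in `s` span an ideal. -/
def SpansIdeal (b : Basis (Fin n) ℝ L) (s : Set (Fin n)) : Prop :=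
  ∃ I : LieIdeal ℝ L, I.toSubmodule = Submodule.span ℝ (b '' s)

/-- The basis is not a disjoint union of two nonempty subsets, each of which spans an ideal. -/
def IsIrreducible (b : Basis (Fin n) ℝ L) : Prop :=
  ¬ ∃ s : Set (Fin n), s.Nonempty ∧ sᶜ.Nonempty ∧ SpansIdeal b s ∧ SpansIdeal b sᶜ

/-- The diagonal endomorphism `v^D`. -/
noncomputable def diagOp (b : Basis (Fin n) ℝ L) (v : Fin n → ℝ) : Module.End ℝ L :=
  b.constr ℝ fun i => v i • b i

/-- The diagonal metric `∑ g_i e^i ⊗ e^i`. -/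
noncomputable def diagMetric (b : Basis (Fin n) ℝ L) (g : Fin n → ℝ) :
    LinearMap.BilinForm ℝ L :=
  ∑ i, g i • LinearMap.BilinForm.linMulLin (b.coord i) (b.coord i)

/-- A Nikolayevsky (pre-Einstein) derivation: semisimple, with `tr (N X) = tr X` for all
derivations `X`. -/
def IsNikolayevsky (N : LieDerivation ℝ L L) : Prop :=
  Module.End.IsSemisimple (N : L →ₗ[ℝ] L) ∧
    ∀ X : LieDerivation ℝ L L,
      LinearMap.trace ℝ L ((N : L →ₗ[ℝ] L) ∘ₗ (X : L →ₗ[ℝ] L)) =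
        LinearMap.trace ℝ L (X : L →ₗ[ℝ] L)

/-- `v^D` is the diagonal Nikolayevsky derivation of the nice Lie algebra. -/
def IsDiagonalNikolayevsky (b : Basis (Fin n) ℝ L) (v : Fin n → ℝ) : Prop :=
  ∃ N : LieDerivation ℝ L L, (N : L →ₗ[ℝ] L) = diagOp b v ∧ IsNikolayevsky N

/-- The diagonal metric `g` satisfies `Ric = -½ id + ½ N` with `N ≠ 0` the diagonal
Nikolayevsky derivation. -/
def IsNormalizedNilsoliton (b : Basis (Fin n) ℝ L) (g : Fin n → ℝ) : Prop :=
  ∃ v : Fin n → ℝ, IsDiagonalNikolayevsky b v ∧ v ≠ 0 ∧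
    IsRicciOperator (diagMetric b g)
      (-(1 / 2 : ℝ) • (1 : Module.End ℝ L) + (1 / 2 : ℝ) • diagOp b v)

/-- The set of signatures of the diagonal metrics with `Ric = -½ id + ½ N`, `N ≠ 0`; the signature
of `g` is recorded as the set of indices with `g_i < 0`. -/
def signatures (b : Basis (Fin n) ℝ L) : Set (Finset (Fin n)) :=
  {s | ∃ g : Fin n → ℝ, (∀ i, g i ≠ 0) ∧ (∀ i, i ∈ s ↔ g i < 0) ∧ IsNormalizedNilsoliton b g}

end Nice

/-! ### The table -/

/-- A row of the table. Indices are written `1, …, n` as usual.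
`d`: the components of `(de^1, …, de^n)`, each the list of its terms; `(a, i, j)` stands for
`a e^i ∧ e^j`.
`scale`, `weights`: `N` is `scale * weights` on the diagonal.
`sig`: the signatures, each given by the list of the indices `i` with `g_i < 0`. -/
structure Row where
  d : List (List (ℤ × ℕ × ℕ))
  scale : ℚ
  weights : List ℤ
  sig : List (List ℕ)

namespace Row

/-- The dimension. -/
def n (r : Row) : ℕ := r.d.length

/-- The structure constant `c_{ij}^k = - de^k (e_i, e_j)`. -/
def structConst (r : Row) (i j k : Fin r.n) : ℤ :=
  -((r.d.get k).map fun t =>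
    t.1 * ((if t.2.1 = (i : ℕ) + 1 ∧ t.2.2 = (j : ℕ) + 1 then 1 else 0) -
      (if t.2.1 = (j : ℕ) + 1 ∧ t.2.2 = (i : ℕ) + 1 then 1 else 0))).sum

/-- The diagonal of `N`. -/
def nik (r : Row) (i : Fin r.n) : ℝ := ((r.scale * r.weights.getD i 0 : ℚ) : ℝ)

/-- The set `S` of signatures. -/
def sigSet (r : Row) : Set (Finset (Fin r.n)) :=
  {s | ∃ l ∈ r.sig, ∀ i : Fin r.n, i ∈ s ↔ (i : ℕ) + 1 ∈ l}

end Row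

/-- The basis `b` satisfies the structure equations of the row `r`. -/
def HasStructure {L : Type*} [LieRing L] [LieAlgebra ℝ L] (r : Row)
    (b : Basis (Fin r.n) ℝ L) : Prop :=
  ∀ i j, ⁅b i, b j⁆ = ∑ k, (r.structConst i j k : ℝ) • b k

/-- The nice Lie algebra `(L, b)` is that of row `r`, up to the relabelling `e` and a nonzero
rescaling of the basis elements. -/
def IsEquivalentTo {L : Type*} [LieRing L] [LieAlgebra ℝ L] {n : ℕ} (b : Basis (Fin n) ℝ L)
    (r : Row) (e : Fin r.n ≃ Fin n) : Prop :=
  ∃ c : Fin r.n → ℝˣ, HasStructure r ((b.reindex e.symm).unitsSMul c)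

/-- The form `e^{ij}`. -/
abbrev e (i j : ℕ) : ℤ × ℕ × ℕ := (1, i, j)

/-- The form `- e^{ij}`. -/
abbrev neg (i j : ℕ) : ℤ × ℕ × ℕ := (-1, i, j)

/-- The irreducible nice nilpotent Lie algebras of dimension `2, …, 6`, with the diagonal
Nikolayevsky derivation and the set of signatures. -/
def table : List Row :=
  [
   -- 31:1
   ⟨[[], [], [e 1 2]],
    2/3, [1, 1, 2],
    [[], [1, 2], [1, 3], [2, 3]]⟩,
   -- 421:1
   ⟨[[], [], [e 1 2], [e 1 3]],
    1/3, [1, 2, 3, 4],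
    [[], [1, 2, 4], [1, 3], [2, 3, 4]]⟩,
   -- 5321:1
   ⟨[[], [], [e 1 2], [e 1 3], [e 1 4]],
    1/12, [2, 9, 11, 13, 15],
    [[], [1, 2, 4], [1, 3, 5], [2, 3, 4, 5]]⟩,
   -- 5321:2
   ⟨[[], [], [e 1 2], [e 1 3], [e 1 4, e 2 3]],
    3/11, [1, 2, 3, 4, 5],
    [[], [1, 3, 5]]⟩,
   -- 532:1
   ⟨[[], [], [e 1 2], [e 1 3], [e 2 3]],
    5/12, [1, 1, 2, 3, 3],
    [[], [1, 2, 4, 5], [1, 3, 5], [2, 3, 4]]⟩,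
   -- 521:2
   ⟨[[], [], [], [e 1 2], [e 2 4, e 1 3]],
    1/7, [4, 3, 6, 7, 10],
    [[], [1, 2, 5], [1, 4, 5], [2, 4]]⟩,
   -- 52:1
   ⟨[[], [], [], [e 1 2], [e 1 3]],
    1/4, [2, 3, 3, 5, 5],
    [[], [1, 2, 3], [1, 2, 5], [1, 3, 4], [1, 4, 5], [2, 3, 4, 5], [2, 4], [3, 5]]⟩,
   -- 51:2
   ⟨[[], [], [], [], [e 1 2, e 3 4]],
    3/4, [1, 1, 1, 1, 2],
    [[], [1, 2], [1, 2, 3, 4], [1, 3, 5], [1, 4, 5], [2, 3, 5], [2, 4, 5], [3, 4]]⟩,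
   -- 64321:1
   ⟨[[], [], [e 1 2], [e 1 3], [e 1 4], [e 1 5]],
    1/11, [1, 9, 10, 11, 12, 13],
    [[], [1, 2, 4, 6], [1, 3, 5], [2, 3, 4, 5, 6]]⟩,
   -- 64321:2
   ⟨[[], [], [e 1 2], [e 1 3], [e 1 4], [e 1 5, e 2 3]],
    13/68, [1, 3, 4, 5, 6, 7],
    [[], [1, 2, 4, 6]]⟩,
   -- 64321:3
   ⟨[[], [], [neg 1 2], [e 1 3], [e 1 4], [e 3 4, e 2 5]],
    1/6, [1, 3, 4, 5, 6, 9],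
    [[], [1, 2, 4, 6], [1, 3, 5, 6], [2, 3, 4, 5]]⟩,
   -- 64321:4
   ⟨[[], [], [e 1 2], [e 1 3], [e 2 3, e 1 4], [e 2 4, e 1 5]],
    3/13, [1, 2, 3, 4, 5, 6],
    [[], [1, 3, 5]]⟩,
   -- 64321:5
   ⟨[[], [], [neg 1 2], [e 1 3], [e 2 3, e 1 4], [e 3 4, e 2 5]],
    11/52, [1, 2, 3, 4, 5, 7],
    [[], [1, 3, 5, 6]]⟩,
   -- 6431:1
   ⟨[[], [], [e 1 2], [e 1 3], [e 2 3], [e 1 4]],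
    1/4, [1, 2, 3, 4, 5, 5],
    [[], [1, 2, 4, 5], [1, 3, 5, 6], [2, 3, 4, 6]]⟩,
   -- 6431:2a
   ⟨[[], [], [e 1 2], [e 1 3], [e 2 3], [e 1 4, e 2 5]],
    7/20, [1, 1, 2, 3, 3, 4],
    [[], [1, 2, 4, 5], [1, 3, 5, 6], [2, 3, 4, 6]]⟩,
   -- 6431:2b
   ⟨[[], [], [e 1 2], [neg 1 3], [e 2 3], [e 1 4, e 2 5]],
    7/20, [1, 1, 2, 3, 3, 4],
    [[], [1, 2, 4, 5], [1, 3, 5, 6], [2, 3, 4, 6]]⟩,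
   -- 6431:3
   ⟨[[], [], [e 1 2], [e 1 3], [e 2 3], [e 2 4, e 1 5]],
    7/20, [1, 1, 2, 3, 3, 4],
    [[], [1, 2, 4, 5], [1, 3, 5], [2, 3, 4]]⟩,
   -- 6321:2
   ⟨[[], [], [], [e 1 2], [e 1 4], [e 1 5, e 2 3]],
    1/15, [4, 9, 12, 13, 17, 21],
    [[], [1, 2, 3, 5], [1, 3, 4, 6], [2, 4, 5, 6]]⟩,
   -- 6321:4
   ⟨[[], [], [], [neg 1 2], [e 1 4, e 2 3], [e 1 5, e 3 4]],
    1/20, [6, 11, 12, 17, 23, 29],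
    [[], [1, 2, 5], [1, 4, 6], [2, 4, 5, 6]]⟩,
   -- 632:2
   ⟨[[], [], [], [e 1 2], [e 1 4], [e 2 4, e 1 3]],
    1/13, [5, 6, 12, 11, 16, 17],
    [[], [1, 2, 5, 6], [1, 4, 6], [2, 4, 5]]⟩,
   -- 632:3a
   ⟨[[], [], [], [e 1 2], [e 2 3, e 1 4], [e 1 3, e 2 4]],
    3/7, [1, 1, 2, 2, 3, 3],
    [[], [1, 2, 5, 6], [1, 4, 6], [2, 4, 5]]⟩,
   -- 632:3b
   ⟨[[], [], [], [e 1 2], [e 2 3, neg 1 4], [e 2 4, e 1 3]],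
    3/7, [1, 1, 2, 2, 3, 3],
    [[], [1, 2, 5, 6], [1, 4, 6], [2, 4, 5]]⟩,
   -- 631:1
   ⟨[[], [], [], [e 1 2], [e 1 3], [e 1 4]],
    1/7, [2, 5, 6, 7, 8, 9],
    [[], [1, 2, 3, 6], [1, 2, 5, 6], [1, 3, 4], [1, 4, 5], [2, 3, 4, 5, 6], [2, 4, 6], [3, 5]]⟩,
   -- 631:2
   ⟨[[], [], [], [e 1 2], [e 1 3], [e 2 4]],
    1/12, [6, 5, 9, 11, 15, 16],
    [[], [1, 2, 3, 6], [1, 2, 5, 6], [1, 3, 4, 6], [1, 4, 5, 6], [2, 3, 4, 5], [2, 4], [3, 5]]⟩,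
   -- 631:3
   ⟨[[], [], [], [e 1 2], [e 1 3], [e 2 3, e 1 4]],
    1/8, [3, 5, 6, 8, 9, 11],
    [[], [1, 2, 5, 6], [1, 4, 5], [2, 4, 6]]⟩,
   -- 631:4
   ⟨[[], [], [], [e 1 2], [e 1 3], [e 2 4, e 1 5]],
    2/11, [2, 3, 4, 5, 6, 8],
    [[], [1, 2, 3, 6], [1, 3, 4, 6], [2, 4]]⟩,
   -- 631:5a
   ⟨[[], [], [], [e 1 2], [e 1 3], [e 3 5, e 2 4]],
    1/2, [1, 1, 1, 2, 2, 3],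
    [[], [1, 2, 3, 6], [1, 2, 5, 6], [1, 3, 4, 6], [1, 4, 5, 6], [2, 3, 4, 5], [2, 4], [3, 5]]⟩,
   -- 631:5b
   ⟨[[], [], [], [neg 1 2], [e 1 3], [e 2 4, e 3 5]],
    1/2, [1, 1, 1, 2, 2, 3],
    [[], [1, 2, 3, 6], [1, 2, 5, 6], [1, 3, 4, 6], [1, 4, 5, 6], [2, 3, 4, 5], [2, 4], [3, 5]]⟩,
   -- 631:6
   ⟨[[], [], [], [e 1 2], [e 1 3], [e 3 4, e 2 5]],
    1/2, [1, 1, 1, 2, 2, 3],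
    [[], [1, 2, 3, 6], [1, 2, 5], [1, 3, 4], [1, 4, 5, 6], [2, 3, 4, 5], [2, 4, 6], [3, 5, 6]]⟩,
   -- 63:1
   ⟨[[], [], [], [e 1 2], [e 1 3], [e 2 3]],
    3/5, [1, 1, 1, 2, 2, 2],
    [[], [1, 2, 3], [1, 2, 5, 6], [1, 3, 4, 6], [1, 4, 5], [2, 3, 4, 5], [2, 4, 6], [3, 5, 6]]⟩,
   -- 621:3
   ⟨[[], [], [], [], [e 1 2], [e 1 5, e 3 4]],
    1/12, [5, 8, 9, 9, 13, 18],
    [[], [1, 2, 3, 6], [1, 2, 4, 6], [1, 3, 4, 5], [1, 5], [2, 3, 5, 6], [2, 4, 5, 6], [3, 4]]⟩,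
   -- 62:3
   ⟨[[], [], [], [], [e 1 2], [e 1 3, e 2 4]],
    1/5, [3, 3, 4, 4, 6, 7],
    [[], [1, 2, 3, 4], [1, 2, 6], [1, 3, 5], [1, 4, 5, 6], [2, 3, 5, 6], [2, 4, 5], [3, 4, 6]]⟩,
   -- 62:4a
   ⟨[[], [], [], [], [e 1 3, e 2 4], [e 3 4, e 1 2]],
    2/3, [1, 1, 1, 1, 2, 2],
    [[], [1, 2, 3, 4], [1, 2, 5], [1, 3, 6], [1, 4, 5, 6], [2, 3, 5, 6], [2, 4, 6], [3, 4, 5]]⟩,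
   -- 62:4b
   ⟨[[], [], [], [], [e 2 4, neg 1 3], [e 3 4, e 1 2]],
    2/3, [1, 1, 1, 1, 2, 2],
    [[], [1, 2, 3, 4], [1, 2, 5], [1, 3, 6], [1, 4, 5, 6], [2, 3, 5, 6], [2, 4, 6], [3, 4, 5]]⟩
  ]

end NiceNilsoliton

/-!
Order a nice basis compatibly with the lower central series. The Ricci operator of a diagonal metric
is then diagonal, and it is a linear expression in the monomials `x_a = c_a² g_k / (g_i g_j)`
attached to the arrows `a = {i, j} → k`, that is, to the nonzero structure constants `c_a`. The
nilsoliton equation becomes the linear system `∑ a, x_a • root_a = 1 - N`, where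
`root_a = ε_i + ε_j - ε_k`. When the vectors `root_a` are linearly independent, which integral dual
vectors certify, its solution `x` is unique; it is positive, so the signs of `g` solve the parity
conditions `sign g_i · sign g_j = sign g_k`, and conversely `g` is recovered from its signs by
solving monomial equations. In the remaining rows one arrow `a₀` is dependent on the others, either
only modulo `2`, which is harmless for `x` and accounts for the pairs of rows marked `a` and `b`, or
over `ℝ`, in which case a Jacobi identity with two terms supplies the missing monomial relation.

For the classification, there are finitely many diagrams of arrows compatible with the order. Each
of them is disconnected, or forces a Jacobi identity with exactly one nonzero term, or is isomorphic
to the diagram of a row. In the last case rescaling the basis brings the structure constants to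
their values in the table, up to a change of sign at `a₀`, which leads to the partner row.
-/

namespace NiceNilsoliton

/-! ### Structure constants -/

section LieCoeff

variable {R L ι : Type*} [CommRing R] [LieRing L] [LieAlgebra R L]

/-- The structure constants of a Lie algebra with respect to a basis. -/
noncomputable def lieCoeff (b : Basis ι R L) (i j k : ι) : R := b.repr ⁅b i, b j⁆ k

variable (b : Basis ι R L)

lemma lieCoeff_skew (i j k : ι) : lieCoeff b j i k = -lieCoeff b i j k := by
  simp only [lieCoeff]
  rw [← lie_skew, map_neg, Finsupp.neg_apply]

lemma lieCoeff_self (i k : ι) : lieCoeff b i i k = 0 := by simp [lieCoeff]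

variable [Fintype ι]

lemma lie_basis (i j : ι) : ⁅b i, b j⁆ = ∑ k, lieCoeff b i j k • b k := (b.sum_repr _).symm

lemma repr_map_eq_sum (f : L →ₗ[R] L) (x : L) (k : ι) :
    b.repr (f x) k = ∑ i, b.repr x i * b.repr (f (b i)) k := by
  conv_lhs => rw [← b.sum_repr x]
  simp only [map_sum, map_smul, Finsupp.coe_finsetSum, Finset.sum_apply, Finsupp.smul_apply,
    smul_eq_mul]

lemma repr_lie_basis_left (x : L) (i k : ι) :
    b.repr ⁅b i, x⁆ k = ∑ j, b.repr x j * lieCoeff b i j k :=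
  repr_map_eq_sum b (LieAlgebra.ad R L (b i)) x k

lemma repr_lie_lie_basis (i j k u : ι) :
    b.repr ⁅b k, ⁅b i, b j⁆⁆ u = -∑ w, lieCoeff b i j w * lieCoeff b w k u := by
  rw [repr_lie_basis_left, ← Finset.sum_neg_distrib]
  refine Finset.sum_congr rfl fun w _ => ?_
  rw [lieCoeff_skew b w k u, ← lieCoeff, mul_neg]

lemma lieCoeff_jacobi (i j k u : ι) :
    ∑ w, (lieCoeff b i j w * lieCoeff b w k u + lieCoeff b j k w * lieCoeff b w i u +
      lieCoeff b k i w * lieCoeff b w j u) = 0 := by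
  have jacobi := congrArg (fun x => b.repr x u) (lie_jacobi (b i) (b j) (b k))
  simp only [map_add, Finsupp.add_apply, map_zero, Finsupp.zero_apply, repr_lie_lie_basis]
    at jacobi
  simp only [Finset.sum_add_distrib]
  linear_combination -jacobi

end LieCoeff

section Tensor

variable {R S ι : Type*} [Zero R] [Zero S]

/-- The support condition on structure constants which characterizes nice bases. -/
structure IsNiceTensor (c : ι → ι → ι → R) : Prop where
  tgt_unique : ∀ ⦃i j k k'⦄, c i j k ≠ 0 → c i j k' ≠ 0 → k = k'
  src_unique : ∀ ⦃i j j' k⦄, c i j k ≠ 0 → c i j' k ≠ 0 → j = j'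

/-- Structure constants with respect to a basis ordered compatibly with the lower central
series. -/
def IsTriangular [LT ι] (c : ι → ι → ι → R) : Prop :=
  ∀ ⦃i j k⦄, c i j k ≠ 0 → i < k ∧ j < k

variable {c : ι → ι → ι → R} {d : ι → ι → ι → S}

lemma IsNiceTensor.of_ne_zero (hc : IsNiceTensor c) (hdc : ∀ i j k, d i j k ≠ 0 → c i j k ≠ 0) :
    IsNiceTensor d where
  tgt_unique _ _ _ _ h h' := hc.tgt_unique (hdc _ _ _ h) (hdc _ _ _ h')
  src_unique _ _ _ _ h h' := hc.src_unique (hdc _ _ _ h) (hdc _ _ _ h')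

lemma IsTriangular.of_ne_zero [LT ι] (hc : IsTriangular c)
    (hdc : ∀ i j k, d i j k ≠ 0 → c i j k ≠ 0) : IsTriangular d :=
  fun _ _ _ h => hc (hdc _ _ _ h)

end Tensor

lemma IsTriangular.mul_eq_zero {R ι : Type*} [MulZeroClass R] [Preorder ι]
    {c : ι → ι → ι → R} (hc : IsTriangular c) (i j k l : ι) : c i j k * c k l i = 0 := by
  by_contra hne
  exact lt_asymm (hc (left_ne_zero_of_mul hne)).1 (hc (right_ne_zero_of_mul hne)).1

lemma IsTriangular.apply_left_eq_zero {R ι : Type*} [Zero R] [Preorder ι]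
    {c : ι → ι → ι → R} (hc : IsTriangular c) (i j : ι) : c i j i = 0 := by
  by_contra hne
  exact lt_irrefl _ (hc hne).1

/-! ### Arrows -/

/-- An arrow `{src₁, src₂} → tgt`, recording that `e_tgt` occurs in the bracket of `e_src₁` and
`e_src₂`. The sources are stored as an ordered pair, so that an arrow also labels a structure
constant including its sign. -/
structure Arrow (ι : Type*) where
  src₁ : ι
  src₂ : ι
  tgt : ι
  deriving DecidableEq

namespace Arrow

variable {ι κ R : Type*}

/-- Arrows as triples. -/
def equivProd (ι : Type*) : Arrow ι ≃ ι × ι × ι where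
  toFun a := (a.src₁, a.src₂, a.tgt)
  invFun p := ⟨p.1, p.2.1, p.2.2⟩

/-- The entry of a tensor labelled by an arrow. -/
def coeff (a : Arrow ι) (c : ι → ι → ι → R) : R := c a.src₁ a.src₂ a.tgt

/-- The pairing of a vector with the incidence vector `ε_i + ε_j - ε_k` of an arrow
`{i, j} → k`. -/
def pairing [Add R] [Sub R] (a : Arrow ι) (v : ι → R) : R := v a.src₁ + v a.src₂ - v a.tgt

/-- The incidence vector `ε_i + ε_j - ε_k` of an arrow `{i, j} → k`. -/
def root [DecidableEq ι] (R : Type*) [AddGroupWithOne R] (a : Arrow ι) (h : ι) : R :=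
  a.pairing (Pi.single h 1)

/-- The multiplicative counterpart of (minus) the incidence vector: the monomial
`t_k / (t_i t_j)` of an arrow `{i, j} → k`. It is the factor by which rescaling the basis by `t`
divides a structure constant. -/
def ratio [Mul R] [Div R] (a : Arrow ι) (t : ι → R) : R := t a.tgt / (t a.src₁ * t a.src₂)

lemma sum_root_mul [Fintype ι] [DecidableEq ι] [Ring R] (a : Arrow ι) (v : ι → R) :
    ∑ h, a.root R h * v h = a.pairing v := by
  simp only [root, pairing, Pi.single_apply, sub_mul, add_mul, ite_mul, one_mul, zero_mul,
    Finset.sum_sub_distrib, Finset.sum_add_distrib, Finset.sum_ite_eq, Finset.mem_univ, if_true]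

lemma sum_mul_root [Fintype ι] [DecidableEq ι] [CommRing R] {X : ι → ι → ι → R}
    (hX : ∀ i j k, X i j k = X j i k) (h : ι) :
    ∑ i, ∑ j, ∑ k, X i j k * root R ⟨i, j, k⟩ h =
      2 * (∑ x, ∑ w, X x h w) - ∑ x, ∑ w, X w x h := by
  simp only [root, pairing, Pi.single_apply, mul_sub, mul_add, mul_ite, mul_one,
    mul_zero, Finset.sum_sub_distrib, Finset.sum_add_distrib, Finset.sum_ite_eq',
    Finset.mem_univ, if_true]
  have sum_src₁ : ∑ i, ∑ j, ∑ k, (if i = h then X i j k else 0) = ∑ x, ∑ w, X x h w := by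
    rw [Finset.sum_eq_single h (by intro i _ hi; simp [hi]) (by simp)]
    simp only [if_true, hX h]
  have sum_src₂ : ∑ i, ∑ j, ∑ k, (if j = h then X i j k else 0) = ∑ x, ∑ w, X x h w := by
    refine Finset.sum_congr rfl fun i _ => ?_
    rw [Finset.sum_eq_single h (by intro j _ hj; simp [hj]) (by simp)]
    simp only [if_true]
  rw [sum_src₁, sum_src₂, Finset.sum_comm (f := fun i j => X i j h)]
  ring

end Arrow

section Arrows

variable {R ι : Type*} [DecidableEq R] [LinearOrder ι] [Fintype ι]

/-- The arrows `{i, j} → k` with `i < j`, given by the nonzero structure constants. -/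
def arrows [Zero R] (c : ι → ι → ι → R) : Finset (Arrow ι) :=
  (Finset.univ.map (Arrow.equivProd ι).symm.toEmbedding).filter
    fun a => a.src₁ < a.src₂ ∧ a.coeff c ≠ 0

lemma mem_arrows [Zero R] {c : ι → ι → ι → R} {a : Arrow ι} :
    a ∈ arrows c ↔ a.src₁ < a.src₂ ∧ a.coeff c ≠ 0 := by
  simp [arrows]

lemma sum_eq_two_mul_sum_arrows [Semiring R] {c F : ι → ι → ι → R}
    (hF_symm : ∀ i j k, F i j k = F j i k) (hF_self : ∀ i k, F i i k = 0)
    (hF_supp : ∀ i j k, c i j k = 0 → F i j k = 0) :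
    ∑ i, ∑ j, ∑ k, F i j k = 2 * ∑ a ∈ arrows c, a.coeff F := by
  classical
  have sum_arrows : ∑ a ∈ arrows c, a.coeff F = ∑ i, ∑ j, ∑ k, if i < j then F i j k else 0 := by
    simp only [arrows, Finset.sum_filter, Finset.sum_map, Fintype.sum_prod_type,
      Equiv.coe_toEmbedding, Arrow.equivProd, Equiv.coe_fn_symm_mk]
    refine Finset.sum_congr rfl fun i _ => Finset.sum_congr rfl fun j _ =>
      Finset.sum_congr rfl fun k _ => ?_
    by_cases hc : c i j k = 0 <;> simp [Arrow.coeff, hc, hF_supp i j k]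
  rw [sum_arrows, two_mul]
  conv_rhs => lhs; rw [Finset.sum_comm]
  simp only [← Finset.sum_add_distrib]
  refine Finset.sum_congr rfl fun i _ => Finset.sum_congr rfl fun j _ =>
    Finset.sum_congr rfl fun k _ => ?_
  rcases lt_trichotomy i j with h | rfl | h
  · simp [h, h.not_gt]
  · simp [hF_self]
  · simp [h, h.not_gt, hF_symm j i k]

end Arrows

/-! ### The Ricci operator of a diagonal metric -/

lemma isLeviCivita_of_basis {L ι : Type*} [LieRing L] [LieAlgebra ℝ L] (b : Basis ι ℝ L)
    {B : LinearMap.BilinForm ℝ L} {D : L →ₗ[ℝ] L →ₗ[ℝ] L}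
    (torsionFree : ∀ i j, D (b i) (b j) - D (b j) (b i) = ⁅b i, b j⁆)
    (metric : ∀ i j k, B (D (b i) (b j)) (b k) + B (b j) (D (b i) (b k)) = 0) :
    IsLeviCivita B D where
  torsionFree x y := by
    have : D - D.flip = (LieAlgebra.ad ℝ L : L →ₗ[ℝ] End ℝ L) :=
      b.ext fun i => b.ext fun j => by simpa using torsionFree i j
    simpa using congrArg (fun f => f x y) this
  metric x y z := by
    have metric_left (i : ι) : B ∘ₗ D (b i) + B.compl₂ (D (b i)) = 0 :=
      b.ext fun j => b.ext fun k => by simpa using metric i j k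
    have : B.flip z ∘ₗ D.flip y + B y ∘ₗ D.flip z = 0 :=
      b.ext fun i => by simpa using congrArg (fun f => f y z) (metric_left i)
    simpa using congrArg (fun f => f x) this

/-- The Ricci tensor as a bilinear form. -/
noncomputable def ricciBilin {L : Type*} [LieRing L] [LieAlgebra ℝ L]
    (D : L →ₗ[ℝ] L →ₗ[ℝ] L) : LinearMap.BilinForm ℝ L :=
  LinearMap.mk₂ ℝ (ricciTensor D)
    (fun y y' z => by
      rw [ricciTensor, ricciTensor, ricciTensor, ← map_add]
      congr 1
      ext x
      simp only [curvature, LinearMap.coe_mk, AddHom.coe_mk, LinearMap.add_apply, map_add, lie_add]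
      abel)
    (fun a y z => by
      rw [ricciTensor, ricciTensor, ← map_smul]
      congr 1
      ext x
      simp only [curvature, LinearMap.coe_mk, AddHom.coe_mk, LinearMap.smul_apply, map_smul,
        lie_smul, smul_sub])
    (fun y z z' => by
      rw [ricciTensor, ricciTensor, ricciTensor, ← map_add]
      congr 1
      ext x
      simp only [curvature, LinearMap.coe_mk, AddHom.coe_mk, LinearMap.add_apply, map_add]
      abel)
    (fun a y z => by
      rw [ricciTensor, ricciTensor, ← map_smul]
      congr 1
      ext x
      simp only [curvature, LinearMap.coe_mk, AddHom.coe_mk, LinearMap.smul_apply, map_smul,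
        smul_sub])

section Ricci

variable {L : Type*} [LieRing L] [LieAlgebra ℝ L] {n : ℕ} (b : Basis (Fin n) ℝ L)
  (g : Fin n → ℝ)

lemma diagMetric_apply (x y : L) :
    diagMetric b g x y = ∑ i, g i * (b.repr x i * b.repr y i) := by
  simp [diagMetric, LinearMap.BilinForm.linMulLin]

lemma diagMetric_basis_right (x : L) (k : Fin n) :
    diagMetric b g x (b k) = g k * b.repr x k := by
  rw [diagMetric_apply, Finset.sum_eq_single k] <;> simp +contextual

lemma diagMetric_basis_left (x : L) (k : Fin n) :
    diagMetric b g (b k) x = g k * b.repr x k := by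
  rw [diagMetric_apply, Finset.sum_eq_single k] <;> simp +contextual

lemma diagOp_basis (v : Fin n → ℝ) (i : Fin n) : diagOp b v (b i) = v i • b i := by
  simp [diagOp]

/-- The Christoffel symbols of a diagonal metric, given by the Koszul formula. -/
noncomputable def christoffel (i j k : Fin n) : ℝ :=
  (lieCoeff b i j k + lieCoeff b k j i * (g i / g k) + lieCoeff b k i j * (g j / g k)) / 2

lemma christoffel_sub_christoffel (i j k : Fin n) :
    christoffel b g i j k - christoffel b g j i k = lieCoeff b i j k := by
  rw [christoffel, christoffel, lieCoeff_skew b i j k]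
  ring

variable {g}

lemma mul_christoffel_add (hg : ∀ i, g i ≠ 0) (i j k : Fin n) :
    g k * christoffel b g i j k + g j * christoffel b g i k j = 0 := by
  have hj := hg j
  have hk := hg k
  rw [christoffel, christoffel, lieCoeff_skew b i k j, lieCoeff_skew b k i j,
    lieCoeff_skew b j i k, lieCoeff_skew b j k i]
  field_simp
  ring

lemma christoffel_eq_zero (hg : ∀ i, g i ≠ 0) (i j : Fin n) : christoffel b g i j j = 0 := by
  have h := mul_christoffel_add b hg i j j
  have : g j * christoffel b g i j j = 0 := by linarith
  exact (mul_eq_zero.mp this).resolve_left (hg j)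

lemma sum_christoffel_eq_zero (hg : ∀ i, g i ≠ 0) (w : Fin n)
    (unimodular : ∑ x, lieCoeff b x w x = 0) : ∑ x, christoffel b g x w x = 0 := by
  rw [← unimodular]
  refine Finset.sum_congr rfl fun x _ => ?_
  rw [← christoffel_sub_christoffel b g x w x, christoffel_eq_zero b hg, sub_zero]

variable {b}

lemma IsLeviCivita.repr_eq (hg : ∀ i, g i ≠ 0) {D : L →ₗ[ℝ] L →ₗ[ℝ] L}
    (h : IsLeviCivita (diagMetric b g) D) (i j k : Fin n) :
    b.repr (D (b i) (b j)) k = christoffel b g i j k := by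
  have torsion (i j k) : b.repr (D (b i) (b j)) k - b.repr (D (b j) (b i)) k
      = lieCoeff b i j k := by
    rw [lieCoeff, ← h.torsionFree, map_sub, Finsupp.sub_apply]
  have metric (i j k) : g k * b.repr (D (b i) (b j)) k + g j * b.repr (D (b i) (b k)) j = 0 := by
    have := h.metric (b i) (b j) (b k)
    rwa [diagMetric_basis_right, diagMetric_basis_left] at this
  have hk := hg k
  rw [christoffel]
  field_simp
  linear_combination g k * torsion i j k + g i * torsion k j i + g j * torsion k i j +
    metric i j k + metric j i k - metric k i j

variable (b g) in
/-- The Levi-Civita connection of a diagonal metric. -/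
noncomputable def leviCivita : L →ₗ[ℝ] L →ₗ[ℝ] L :=
  b.constr ℝ fun i => b.constr ℝ fun j => ∑ k, christoffel b g i j k • b k

lemma repr_leviCivita (i j k : Fin n) :
    b.repr (leviCivita b g (b i) (b j)) k = christoffel b g i j k := by
  simp [leviCivita, Finsupp.finsetSum_apply, Finsupp.single_apply]

lemma isLeviCivita_leviCivita (hg : ∀ i, g i ≠ 0) :
    IsLeviCivita (diagMetric b g) (leviCivita b g) := by
  refine isLeviCivita_of_basis b (fun i j => ?_) fun i j k => ?_
  · refine b.repr.injective (Finsupp.ext fun k => ?_)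
    rw [map_sub, Finsupp.sub_apply, repr_leviCivita, repr_leviCivita,
      christoffel_sub_christoffel, lieCoeff]
  · rw [diagMetric_basis_right, diagMetric_basis_left, repr_leviCivita, repr_leviCivita,
      mul_christoffel_add b hg]

lemma IsLeviCivita.repr_curvature_basis (hg : ∀ i, g i ≠ 0) {D : L →ₗ[ℝ] L →ₗ[ℝ] L}
    (h : IsLeviCivita (diagMetric b g) D) (x y z : Fin n) :
    b.repr (curvature D (b y) (b z) (b x)) x =
      ∑ w, christoffel b g y z w * christoffel b g x w x -
        ∑ w, christoffel b g x z w * christoffel b g y w x -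
        ∑ w, lieCoeff b x y w * christoffel b g w z x := by
  have repr_right (i : Fin n) (v : L) (k : Fin n) :
      b.repr (D (b i) v) k = ∑ w, b.repr v w * christoffel b g i w k := by
    simp only [repr_map_eq_sum b (D (b i)) v k, h.repr_eq hg]
  have repr_left (v : L) (j k : Fin n) :
      b.repr (D v (b j)) k = ∑ w, b.repr v w * christoffel b g w j k := by
    simp only [← h.repr_eq hg]
    exact repr_map_eq_sum b (D.flip (b j)) v k
  change b.repr (D (b x) (D (b y) (b z)) - D (b y) (D (b x) (b z)) - D ⁅b x, b y⁆ (b z)) x = _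
  rw [map_sub, map_sub, Finsupp.sub_apply, Finsupp.sub_apply, repr_right, repr_right, repr_left]
  simp only [h.repr_eq hg, lieCoeff]

lemma IsLeviCivita.ricciTensor_eq_neg_sum (hg : ∀ i, g i ≠ 0) {D : L →ₗ[ℝ] L →ₗ[ℝ] L}
    (h : IsLeviCivita (diagMetric b g) D) (unimodular : ∀ w, ∑ x, lieCoeff b x w x = 0)
    (y z : Fin n) :
    ricciTensor D (b y) (b z) =
      -∑ x, ∑ w, christoffel b g x z w * christoffel b g w y x := by
  have trace_term : ∑ x, ∑ w, christoffel b g y z w * christoffel b g x w x = 0 := by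
    rw [Finset.sum_comm]
    refine Finset.sum_eq_zero fun w _ => ?_
    rw [← Finset.mul_sum, sum_christoffel_eq_zero b hg w (unimodular w), mul_zero]
  have bracket_term : ∑ x, ∑ w, lieCoeff b x y w * christoffel b g w z x =
      ∑ x, ∑ w, (christoffel b g x z w * christoffel b g w y x -
        christoffel b g x z w * christoffel b g y w x) := by
    rw [Finset.sum_comm]
    refine Finset.sum_congr rfl fun x _ => Finset.sum_congr rfl fun w _ => ?_
    rw [← christoffel_sub_christoffel b g w y x]
    ring
  rw [ricciTensor, LinearMap.trace_eq_matrix_trace ℝ b, Matrix.trace]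
  simp only [Matrix.diag_apply, LinearMap.toMatrix_apply, h.repr_curvature_basis hg,
    Finset.sum_sub_distrib, trace_term, bracket_term]
  ring

variable (b g) in
/-- The components of the Ricci tensor of a diagonal metric in terms of the structure constants
with respect to a triangular basis. -/
noncomputable def ricciFormula (y z : Fin n) : ℝ :=
  ∑ x, ∑ w, (-(1 / 2) * (lieCoeff b x y w * lieCoeff b x z w * (g w / g x)) +
    1 / 4 * (lieCoeff b w x y * lieCoeff b w x z * (g y * g z / (g x * g w))))

lemma sum_sum_congr_symm {ι : Type*} [Fintype ι] {F G : ι → ι → ℝ}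
    (h : ∀ x w, F x w + F w x = G x w + G w x) : ∑ x, ∑ w, F x w = ∑ x, ∑ w, G x w := by
  have two_mul_sum (H : ι → ι → ℝ) : 2 * ∑ x, ∑ w, H x w = ∑ x, ∑ w, (H x w + H w x) := by
    simp only [Finset.sum_add_distrib]
    rw [Finset.sum_comm (f := fun x w => H w x)]
    ring
  have := two_mul_sum F
  simp only [h, ← two_mul_sum G] at this
  linarith

lemma neg_sum_christoffel_mul (hb : IsTriangular (lieCoeff b)) (hg : ∀ i, g i ≠ 0)
    (y z : Fin n) :
    -∑ x, ∑ w, christoffel b g x z w * christoffel b g w y x = ricciFormula b g y z := by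
  rw [ricciFormula]
  simp only [← Finset.sum_neg_distrib]
  refine sum_sum_congr_symm fun x w => ?_
  have hx := hg x
  have hw := hg w
  simp only [christoffel, lieCoeff_skew b x w z, lieCoeff_skew b x w y]
  field_simp
  linear_combination (-8 * g x * g w) * hb.mul_eq_zero x z w y +
    (-8 * g x * g w) * hb.mul_eq_zero w z x y

lemma IsLeviCivita.ricciTensor_eq_ricciFormula (hb : IsTriangular (lieCoeff b))
    (hg : ∀ i, g i ≠ 0) {D : L →ₗ[ℝ] L →ₗ[ℝ] L} (h : IsLeviCivita (diagMetric b g) D)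
    (y z : Fin n) : ricciTensor D (b y) (b z) = ricciFormula b g y z := by
  rw [h.ricciTensor_eq_neg_sum hg
    (fun w => Finset.sum_eq_zero fun x _ => hb.apply_left_eq_zero x w),
    neg_sum_christoffel_mul hb hg]

lemma isRicciOperator_iff (hb : IsTriangular (lieCoeff b)) (hg : ∀ i, g i ≠ 0)
    (T : Module.End ℝ L) :
    IsRicciOperator (diagMetric b g) T ↔
      ∀ y z, diagMetric b g (T (b y)) (b z) = ricciFormula b g y z := by
  constructor
  · rintro ⟨D, hD, h⟩ y z
    rw [h, hD.ricciTensor_eq_ricciFormula hb hg]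
  · intro h
    have hD := isLeviCivita_leviCivita (b := b) hg
    have : (diagMetric b g) ∘ₗ T = ricciBilin (leviCivita b g) := by
      refine b.ext fun y => b.ext fun z => ?_
      rw [LinearMap.comp_apply, h, ← hD.ricciTensor_eq_ricciFormula hb hg]
      rfl
    exact ⟨leviCivita b g, hD, fun y z => congrArg (fun f => f y z) this⟩

lemma ricciFormula_eq_zero_of_ne (hb : IsNiceTensor (lieCoeff b)) {y z : Fin n}
    (hyz : y ≠ z) : ricciFormula b g y z = 0 := by
  refine Finset.sum_eq_zero fun x _ => Finset.sum_eq_zero fun w _ => ?_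
  have same_target : lieCoeff b x y w * lieCoeff b x z w = 0 := by
    by_contra hne
    exact hyz (hb.src_unique (left_ne_zero_of_mul hne) (right_ne_zero_of_mul hne))
  have same_source : lieCoeff b w x y * lieCoeff b w x z = 0 := by
    by_contra hne
    exact hyz (hb.tgt_unique (left_ne_zero_of_mul hne) (right_ne_zero_of_mul hne))
  rw [same_target, same_source]
  ring

lemma ricciFormula_self (hg : ∀ i, g i ≠ 0) (h : Fin n) :
    ricciFormula b g h h = -(g h / 2) *
      ∑ a ∈ arrows (lieCoeff b), a.coeff (lieCoeff b) ^ 2 * a.ratio g * a.root ℝ h := by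
  set X : Fin n → Fin n → Fin n → ℝ := fun i j k => lieCoeff b i j k ^ 2 * (g k / (g i * g j))
  have X_symm (i j k) : X i j k = X j i k := by
    simp only [X]
    rw [lieCoeff_skew b j i k, mul_comm (g i), neg_sq]
  have sum_arrows := sum_eq_two_mul_sum_arrows (c := lieCoeff b)
    (F := fun i j k => X i j k * Arrow.root ℝ ⟨i, j, k⟩ h)
    (fun i j k => by simp only [X_symm i j k, Arrow.root, Arrow.pairing]; ring)
    (fun i k => by simp [X, lieCoeff_self]) (fun i j k hc => by simp [X, hc])
  rw [Arrow.sum_mul_root X_symm] at sum_arrows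
  have formula : ricciFormula b g h h
      = g h * (-(1 / 2) * (∑ x, ∑ w, X x h w) + 1 / 4 * ∑ x, ∑ w, X w x h) := by
    simp only [ricciFormula, Finset.mul_sum, ← Finset.sum_add_distrib]
    refine Finset.sum_congr rfl fun x _ => Finset.sum_congr rfl fun w _ => ?_
    have hh := hg h
    have hx := hg x
    have hw := hg w
    simp only [X]
    field_simp
  change _ = -(g h / 2) * ∑ a ∈ arrows (lieCoeff b),
    a.coeff (fun i j k => X i j k * Arrow.root ℝ ⟨i, j, k⟩ h)
  linear_combination formula - g h / 4 * sum_arrows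

lemma isRicciOperator_diagOp_iff (hb : IsNiceTensor (lieCoeff b))
    (hb' : IsTriangular (lieCoeff b)) (hg : ∀ i, g i ≠ 0) (v : Fin n → ℝ) :
    IsRicciOperator (diagMetric b g) (diagOp b v) ↔
      ∀ h, g h * v h = ricciFormula b g h h := by
  have diagMetric_diagOp (y z : Fin n) :
      diagMetric b g (diagOp b v (b y)) (b z) = if y = z then g y * v y else 0 := by
    rw [diagMetric_basis_right, diagOp_basis, map_smul, Finsupp.smul_apply, Basis.repr_self,
      Finsupp.single_apply, smul_eq_mul]
    split_ifs with h
    · rw [h, mul_one]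
    · simp only [mul_zero]
  simp only [isRicciOperator_iff hb' hg, diagMetric_diagOp]
  refine ⟨fun H h => by simpa using H h h, fun H y z => ?_⟩
  split_ifs with hyz
  · rw [H, hyz]
  · rw [ricciFormula_eq_zero_of_ne hb hyz]

lemma neg_half_smul_one_add_half_smul_diagOp (v : Fin n → ℝ) :
    -(1 / 2 : ℝ) • (1 : Module.End ℝ L) + (1 / 2 : ℝ) • diagOp b v
      = diagOp b fun h => (v h - 1) / 2 := by
  refine b.ext fun i => ?_
  simp only [LinearMap.add_apply, LinearMap.smul_apply, Module.End.one_apply, diagOp_basis]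
  module

theorem isRicciOperator_nilsoliton_iff (hb : IsNiceTensor (lieCoeff b))
    (hb' : IsTriangular (lieCoeff b)) (hg : ∀ i, g i ≠ 0) (v : Fin n → ℝ) :
    IsRicciOperator (diagMetric b g)
      (-(1 / 2 : ℝ) • (1 : Module.End ℝ L) + (1 / 2 : ℝ) • diagOp b v) ↔
    ∀ h, ∑ a ∈ arrows (lieCoeff b), a.coeff (lieCoeff b) ^ 2 * a.ratio g * a.root ℝ h
      = 1 - v h := by
  rw [neg_half_smul_one_add_half_smul_diagOp, isRicciOperator_diagOp_iff hb hb' hg]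
  refine forall_congr' fun h => ?_
  rw [ricciFormula_self hg]
  have hh := hg h
  constructor <;> intro H
  · field_simp at H
    linarith
  · rw [H]
    ring

end Ricci

/-! ### Nice, nilpotent and irreducible Lie algebras in terms of structure constants -/

lemma repr_lie {R L ι : Type*} [CommRing R] [LieRing L] [LieAlgebra R L] [Fintype ι]
    (b : Basis ι R L) (x y : L) (k : ι) :
    b.repr ⁅x, y⁆ k = ∑ i, ∑ j, b.repr x i * b.repr y j * lieCoeff b i j k := by
  rw [← lie_skew, map_neg, Finsupp.neg_apply,
    show ⁅y, x⁆ = (LieAlgebra.ad R L y : L →ₗ[R] L) x from rfl, repr_map_eq_sum,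
    ← Finset.sum_neg_distrib]
  refine Finset.sum_congr rfl fun i _ => ?_
  rw [LieAlgebra.ad_apply, ← lie_skew, map_neg, Finsupp.neg_apply, mul_neg, neg_neg,
    repr_lie_basis_left, Finset.mul_sum]
  exact Finset.sum_congr rfl fun j _ => (mul_assoc _ _ _).symm

lemma IsTriangular.repr_eq_zero_of_mem_lowerCentralSeries {R L : Type*} [CommRing R] [LieRing L]
    [LieAlgebra R L] {n : ℕ} {b : Basis (Fin n) R L} (hb : IsTriangular (lieCoeff b)) (m : ℕ) :
    ∀ x ∈ LieModule.lowerCentralSeries R L L m, ∀ k : Fin n, (k : ℕ) < m → b.repr x k = 0 := by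
  induction m with
  | zero => exact fun _ _ _ hk => absurd hk (Nat.not_lt_zero _)
  | succ m ih =>
    intro x hx k hk
    rw [LieModule.lowerCentralSeries_succ, ← LieSubmodule.mem_toSubmodule,
      LieSubmodule.lieIdeal_oper_eq_linear_span'] at hx
    induction hx using Submodule.span_induction with
    | zero => simp
    | add y z _ _ hy hz => rw [map_add, Finsupp.add_apply, hy, hz, add_zero]
    | smul a y _ hy => rw [map_smul, Finsupp.smul_apply, hy, smul_zero]
    | mem y hy =>
      obtain ⟨p, -, q, hq, rfl⟩ := hy
      rw [repr_lie]
      refine Finset.sum_eq_zero fun i _ => Finset.sum_eq_zero fun j _ => ?_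
      by_cases hc : lieCoeff b i j k = 0
      · rw [hc, mul_zero]
      · have := (hb hc).2
        rw [ih q hq j (by omega), mul_zero, zero_mul]

lemma IsTriangular.isNilpotent {R L : Type*} [CommRing R] [LieRing L] [LieAlgebra R L] {n : ℕ}
    {b : Basis (Fin n) R L} (hb : IsTriangular (lieCoeff b)) : LieRing.IsNilpotent L := by
  suffices hn : LieModule.lowerCentralSeries R L L n = ⊥ from LieModule.IsNilpotent.mk L hn
  refine eq_bot_iff.2 fun x hx => ?_
  rw [LieSubmodule.mem_bot]
  refine b.repr.injective (Finsupp.ext fun k => ?_)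
  rw [hb.repr_eq_zero_of_mem_lowerCentralSeries n x hx k k.2, map_zero, Finsupp.zero_apply]

section Depth

variable {R L : Type*} [CommRing R] [LieRing L] [LieAlgebra R L]

variable (R) in
/-- The largest `m` such that `x` lies in the `m`-th term of the lower central series. The value
is meaningful for `x ≠ 0` in a nilpotent Lie algebra, where these `m` are bounded. -/
noncomputable def lowerCentralDepth (x : L) : ℕ :=
  sSup {m | x ∈ LieModule.lowerCentralSeries R L L m}

lemma bddAbove_mem_lowerCentralSeries [LieRing.IsNilpotent L] {x : L} (hx : x ≠ 0) :
    BddAbove {m | x ∈ LieModule.lowerCentralSeries R L L m} := by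
  obtain ⟨N, hN⟩ := LieModule.IsNilpotent.nilpotent (R := R) (L := L) (M := L)
  refine ⟨N, fun m hm => ?_⟩
  by_contra hlt
  have := LieModule.antitone_lowerCentralSeries R L L (not_le.1 hlt).le hm
  rw [hN, LieSubmodule.mem_bot] at this
  exact hx this

lemma mem_lowerCentralSeries_lowerCentralDepth [LieRing.IsNilpotent L] {x : L} (hx : x ≠ 0) :
    x ∈ LieModule.lowerCentralSeries R L L (lowerCentralDepth R x) :=
  Nat.sSup_mem (s := {m | x ∈ LieModule.lowerCentralSeries R L L m}) ⟨0, by simp⟩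
    (bddAbove_mem_lowerCentralSeries hx)

lemma lowerCentralDepth_lt_of_lie_eq_smul {K : Type*} [Field K] [LieAlgebra K L]
    [LieRing.IsNilpotent L] {x y z : L} {c : K} (h : ⁅x, y⁆ = c • z) (hxy : ⁅x, y⁆ ≠ 0) :
    lowerCentralDepth K y < lowerCentralDepth K z := by
  have hc : c ≠ 0 := fun hc => hxy (by rw [h, hc, zero_smul])
  have hz : z ≠ 0 := fun hz => hxy (by rw [h, hz, smul_zero])
  have hy : y ≠ 0 := fun hy => hxy (by rw [hy, lie_zero])
  have lie_mem : ⁅x, y⁆ ∈ LieModule.lowerCentralSeries K L L (lowerCentralDepth K y + 1) := by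
    rw [LieModule.lowerCentralSeries_succ]
    exact LieSubmodule.lie_mem_lie (LieSubmodule.mem_top _)
      (mem_lowerCentralSeries_lowerCentralDepth hy)
  have := SMulMemClass.smul_mem c⁻¹ lie_mem
  rw [h, smul_smul, inv_mul_cancel₀ hc, one_smul] at this
  exact le_csSup (bddAbove_mem_lowerCentralSeries hz) this

end Depth

lemma exists_eq_smul_single_iff {K ι : Type*} [Semiring K] [DecidableEq ι] [Nonempty ι]
    {c : ι → K} :
    (∃ (k : ι) (t : K), c = Pi.single k t) ↔ ∀ k k', c k ≠ 0 → c k' ≠ 0 → k = k' := by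
  constructor
  · rintro ⟨k₀, t, rfl⟩ k k' hk hk'
    have eq_of_ne_zero {l : ι} (hl : (Pi.single k₀ t : ι → K) l ≠ 0) : l = k₀ :=
      of_not_not fun h => hl (Pi.single_eq_of_ne h _)
    exact (eq_of_ne_zero hk).trans (eq_of_ne_zero hk').symm
  · intro h
    by_cases hc : ∃ k, c k ≠ 0
    · obtain ⟨k, hk⟩ := hc
      refine ⟨k, c k, funext fun l => ?_⟩
      rcases eq_or_ne l k with rfl | hl
      · rw [Pi.single_eq_same]
      · rw [Pi.single_eq_of_ne hl]
        by_contra hne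
        exact hl (h l k hne hk)
    · push Not at hc
      exact ⟨Classical.arbitrary ι, 0, by simpa [funext_iff] using hc⟩

section Characterizations

variable {L : Type*} [LieRing L] [LieAlgebra ℝ L] {n : ℕ} {b : Basis (Fin n) ℝ L}

lemma lie_basis_eq_smul_iff (i j k : Fin n) (t : ℝ) :
    ⁅b i, b j⁆ = t • b k ↔ lieCoeff b i j = Pi.single k t := by
  rw [← b.repr.injective.eq_iff, DFunLike.ext_iff, funext_iff]
  refine forall_congr' fun l => ?_
  rw [lieCoeff, map_smul, Basis.repr_self, Finsupp.smul_single_one, Finsupp.single_apply,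
    Pi.single_apply]
  simp only [eq_comm]

lemma interiorDiff_eq_smul_iff (i j k : Fin n) (t : ℝ) :
    interiorDiff b i k = t • b.coord j ↔ (fun l => -lieCoeff b i l k) = Pi.single j t := by
  have interiorDiff_basis (l : Fin n) : interiorDiff b i k (b l) = -lieCoeff b i l k := rfl
  have smul_coord_basis (l : Fin n) : (t • b.coord j) (b l) = (Pi.single j t : Fin n → ℝ) l := by
    rw [LinearMap.smul_apply, Basis.coord_apply, Basis.repr_self, Finsupp.single_apply,
      Pi.single_apply, smul_eq_mul, mul_ite, mul_one, mul_zero]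
  rw [funext_iff]
  constructor
  · intro h l
    rw [← interiorDiff_basis, h, smul_coord_basis]
  · intro h
    refine b.ext fun l => ?_
    rw [interiorDiff_basis, h, smul_coord_basis]

lemma isNice_iff : IsNice b ↔ IsNiceTensor (lieCoeff b) := by
  have bracket_iff (i j : Fin n) : (∃ (k : Fin n) (t : ℝ), ⁅b i, b j⁆ = t • b k) ↔
      ∀ k k', lieCoeff b i j k ≠ 0 → lieCoeff b i j k' ≠ 0 → k = k' := by
    have : Nonempty (Fin n) := ⟨i⟩
    simp only [lie_basis_eq_smul_iff, exists_eq_smul_single_iff]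
  have interior_iff (i k : Fin n) :
      (∃ (j : Fin n) (t : ℝ), interiorDiff b i k = t • b.coord j) ↔
      ∀ j j', lieCoeff b i j k ≠ 0 → lieCoeff b i j' k ≠ 0 → j = j' := by
    have : Nonempty (Fin n) := ⟨i⟩
    simp only [interiorDiff_eq_smul_iff, exists_eq_smul_single_iff, neg_ne_zero]
  constructor
  · rintro ⟨hb, hi⟩
    exact ⟨fun i j => (bracket_iff i j).1 (hb i j),
      fun i j j' k => (interior_iff i k).1 (hi i k) j j'⟩
  · rintro ⟨hb, hi⟩
    exact ⟨fun i j => (bracket_iff i j).2 fun _ _ => @hb i j _ _,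
      fun i k => (interior_iff i k).2 fun j j' => @hi i j j' k⟩

lemma IsNice.lowerCentralDepth_lt [LieRing.IsNilpotent L] (hb : IsNice b) {i j k : Fin n}
    (hc : lieCoeff b i j k ≠ 0) :
    lowerCentralDepth ℝ (b i) < lowerCentralDepth ℝ (b k) ∧
      lowerCentralDepth ℝ (b j) < lowerCentralDepth ℝ (b k) := by
  have depth_right_lt {i j k : Fin n} (hc : lieCoeff b i j k ≠ 0) :
      lowerCentralDepth ℝ (b j) < lowerCentralDepth ℝ (b k) := by
    obtain ⟨k', t, hk'⟩ := hb.bracket i j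
    have hkk' : k = k' := by
      rw [(lie_basis_eq_smul_iff i j k' t).1 hk'] at hc
      exact of_not_not fun h => hc (Pi.single_eq_of_ne h _)
    refine lowerCentralDepth_lt_of_lie_eq_smul (hkk' ▸ hk') fun h => hc ?_
    rw [lieCoeff, h, map_zero, Finsupp.zero_apply]
  refine ⟨depth_right_lt (i := j) ?_, depth_right_lt hc⟩
  rwa [lieCoeff_skew, neg_ne_zero]

lemma spansIdeal_iff (s : Set (Fin n)) :
    SpansIdeal b s ↔ ∀ i j k, i ∈ s → lieCoeff b i j k ≠ 0 → k ∈ s := by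
  have mem_span_iff (x : L) :
      x ∈ Submodule.span ℝ (b '' s) ↔ ∀ k, b.repr x k ≠ 0 → k ∈ s := by
    rw [b.mem_span_image]
    simp [Set.subset_def]
  constructor
  · rintro ⟨I, hI⟩ i j k hi hc
    have hbi : b i ∈ I := by
      rw [← LieSubmodule.mem_toSubmodule, hI]
      exact Submodule.subset_span ⟨i, hi, rfl⟩
    have : ⁅b i, b j⁆ ∈ I := lie_mem_left ℝ L I (b i) (b j) hbi
    rw [← LieSubmodule.mem_toSubmodule, hI, mem_span_iff] at this
    exact this k hc
  · intro h
    refine ⟨{ Submodule.span ℝ (b '' s) with lie_mem := ?_ }, rfl⟩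
    intro x y hy
    change y ∈ Submodule.span ℝ (b '' s) at hy
    change ⁅x, y⁆ ∈ Submodule.span ℝ (b '' s)
    rw [mem_span_iff] at hy ⊢
    intro k hk
    rw [repr_lie] at hk
    obtain ⟨i, -, hi⟩ := Finset.exists_ne_zero_of_sum_ne_zero hk
    obtain ⟨j, -, hj⟩ := Finset.exists_ne_zero_of_sum_ne_zero hi
    refine h j i k (hy j (right_ne_zero_of_mul (left_ne_zero_of_mul hj))) ?_
    rw [lieCoeff_skew, neg_ne_zero]
    exact right_ne_zero_of_mul hj

lemma spansIdeal_and_compl_iff (s : Set (Fin n)) : SpansIdeal b s ∧ SpansIdeal b sᶜ ↔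
    ∀ i j k, lieCoeff b i j k ≠ 0 → (i ∈ s ↔ k ∈ s) := by
  rw [spansIdeal_iff, spansIdeal_iff]
  constructor
  · rintro ⟨hs, hs'⟩ i j k hc
    refine ⟨fun hi => hs i j k hi hc, fun hk => ?_⟩
    by_contra hi
    exact hs' i j k hi hc hk
  · intro h
    exact ⟨fun i j k hi hc => (h i j k hc).1 hi, fun i j k hi hc hk => hi ((h i j k hc).2 hk)⟩

lemma isIrreducible_iff : IsIrreducible b ↔
    ∀ s : Set (Fin n), (∀ i j k, lieCoeff b i j k ≠ 0 → (i ∈ s ↔ k ∈ s)) → s.Nonempty →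
      s = Set.univ := by
  simp only [IsIrreducible, spansIdeal_and_compl_iff, not_exists, not_and]
  refine forall_congr' fun s => ?_
  rw [← Set.compl_empty_iff, ← Set.not_nonempty_iff_eq_empty]
  tauto

end Characterizations

/-! ### The diagonal Nikolayevsky derivation -/

section Nikolayevsky

variable {L : Type*} [LieRing L] [LieAlgebra ℝ L] {n : ℕ} {b : Basis (Fin n) ℝ L}

lemma repr_diagOp (v : Fin n → ℝ) (x : L) (i : Fin n) :
    b.repr (diagOp b v x) i = v i * b.repr x i := by
  rw [repr_map_eq_sum, Finset.sum_eq_single i]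
  · simp [diagOp_basis, mul_comm]
  · intro j _ hj
    simp [diagOp_basis, hj]
  · simp

lemma isSemisimple_diagOp (v : Fin n → ℝ) : (diagOp b v).IsSemisimple := by
  classical
  set p : Polynomial ℝ := ∏ a ∈ Finset.univ.image v, (Polynomial.X - Polynomial.C a) with hp
  have squarefree : Squarefree p :=
    (Polynomial.separable_prod_X_sub_C_iff'.2 fun x _ y _ h => h).squarefree
  refine Module.End.isSemisimple_of_squarefree_aeval_eq_zero squarefree (b.ext fun i => ?_)
  have hi : v i ∈ Finset.univ.image v := Finset.mem_image_of_mem _ (Finset.mem_univ i)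
  rw [hp, ← Finset.prod_erase_mul _ _ hi, map_mul, Module.End.mul_apply]
  simp [diagOp_basis]

lemma trace_eq_sum_repr {R M ι : Type*} [CommRing R] [AddCommGroup M] [Module R M] [Fintype ι]
    (b : Basis ι R M) (f : M →ₗ[R] M) : LinearMap.trace R M f = ∑ i, b.repr (f (b i)) i := by
  classical
  rw [LinearMap.trace_eq_matrix_trace R b, Matrix.trace]
  exact Finset.sum_congr rfl fun i _ => by rw [Matrix.diag_apply, LinearMap.toMatrix_apply]

lemma diagOp_lie {v : Fin n → ℝ} (hv : ∀ i j k, lieCoeff b i j k ≠ 0 → v i + v j = v k)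
    (x y : L) : diagOp b v ⁅x, y⁆ = ⁅x, diagOp b v y⁆ - ⁅y, diagOp b v x⁆ := by
  rw [← lie_skew y, sub_neg_eq_add]
  refine b.repr.injective (Finsupp.ext fun k => ?_)
  rw [repr_diagOp, map_add, Finsupp.add_apply, repr_lie, repr_lie, repr_lie, Finset.mul_sum,
    ← Finset.sum_add_distrib]
  refine Finset.sum_congr rfl fun i _ => ?_
  rw [Finset.mul_sum, ← Finset.sum_add_distrib]
  refine Finset.sum_congr rfl fun j _ => ?_
  rw [repr_diagOp, repr_diagOp]
  by_cases hc : lieCoeff b i j k = 0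
  · simp only [hc, mul_zero, add_zero]
  · rw [← hv i j k hc]
    ring

/-- The diagonal derivation with eigenvalues `v`. -/
noncomputable def diagDerivation (v : Fin n → ℝ)
    (hv : ∀ i j k, lieCoeff b i j k ≠ 0 → v i + v j = v k) : LieDerivation ℝ L L where
  toLinearMap := diagOp b v
  leibniz' := diagOp_lie hv

lemma IsNiceTensor.lie_basis_eq_smul {R L ι : Type*} [CommRing R] [LieRing L] [LieAlgebra R L]
    {b : Basis ι R L} (hb : IsNiceTensor (lieCoeff b)) {i j k : ι}
    (hc : lieCoeff b i j k ≠ 0) : ⁅b i, b j⁆ = lieCoeff b i j k • b k := by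
  refine b.repr.injective (Finsupp.ext fun k' => ?_)
  rw [map_smul, Basis.repr_self, Finsupp.smul_single, smul_eq_mul, mul_one]
  change lieCoeff b i j k' = _
  by_cases hk : k = k'
  · rw [← hk, Finsupp.single_eq_same]
  · rw [Finsupp.single_eq_of_ne' hk]
    exact not_not.1 (mt (hb.tgt_unique hc) hk)

lemma IsNiceTensor.repr_lie_basis_left {R L ι : Type*} [CommRing R] [LieRing L]
    [LieAlgebra R L] {b : Basis ι R L} (hb : IsNiceTensor (lieCoeff b)) {i j k : ι}
    (hc : lieCoeff b i j k ≠ 0) (x : L) :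
    b.repr ⁅b i, x⁆ k = b.repr x j * lieCoeff b i j k := by
  suffices b.coord k ∘ₗ (LieAlgebra.ad R L (b i) : L →ₗ[R] L) = lieCoeff b i j k • b.coord j by
    simpa [mul_comm] using congrArg (fun f => f x) this
  refine b.ext fun j' => ?_
  change lieCoeff b i j' k = lieCoeff b i j k * b.repr (b j') j
  by_cases hj : j = j'
  · rw [← hj, Basis.repr_self, Finsupp.single_eq_same, mul_one]
  · rw [Basis.repr_self, Finsupp.single_eq_of_ne hj, mul_zero]
    exact not_not.1 (mt (hb.src_unique hc) hj)

lemma IsNiceTensor.repr_derivation_diag {R L ι : Type*} [CommRing R] [IsDomain R] [LieRing L]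
    [LieAlgebra R L] {b : Basis ι R L} (hb : IsNiceTensor (lieCoeff b))
    (X : LieDerivation R L L) {i j k : ι} (hc : lieCoeff b i j k ≠ 0) :
    b.repr (X (b i)) i + b.repr (X (b j)) j = b.repr (X (b k)) k := by
  have leibniz := congrArg (fun x => b.repr x k) (X.apply_lie_eq_sub (b i) (b j))
  have hc' : lieCoeff b j i k ≠ 0 := by rwa [lieCoeff_skew, neg_ne_zero]
  simp only [hb.lie_basis_eq_smul hc, map_smul, map_sub, Finsupp.smul_apply, Finsupp.sub_apply,
    smul_eq_mul, hb.repr_lie_basis_left hc, hb.repr_lie_basis_left hc',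
    lieCoeff_skew b i j k] at leibniz
  refine mul_left_cancel₀ hc ?_
  linear_combination -leibniz

lemma trace_diagOp_comp (v : Fin n → ℝ) (f : L →ₗ[ℝ] L) :
    LinearMap.trace ℝ L (diagOp b v ∘ₗ f) = ∑ i, v i * b.repr (f (b i)) i := by
  simp only [trace_eq_sum_repr b, LinearMap.comp_apply, repr_diagOp]

/-- If `1 - v` is a combination of the incidence vectors, then `diag (1 - v)` is orthogonal to
all derivations for the trace form, because the diagonal part of a derivation of a nice Lie
algebra is again a derivation. -/
lemma isDiagonalNikolayevsky_of_sum_root (hb : IsNiceTensor (lieCoeff b)) {v : Fin n → ℝ}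
    (hv : ∀ i j k, lieCoeff b i j k ≠ 0 → v i + v j = v k) (x : Arrow (Fin n) → ℝ)
    (hx : ∀ h, ∑ a ∈ arrows (lieCoeff b), x a * a.root ℝ h = 1 - v h) :
    IsDiagonalNikolayevsky b v := by
  refine ⟨diagDerivation v hv, rfl, isSemisimple_diagOp v, fun X => ?_⟩
  change LinearMap.trace ℝ L (diagOp b v ∘ₗ (X : L →ₗ[ℝ] L)) = _
  rw [trace_diagOp_comp, trace_eq_sum_repr b]
  set d : Fin n → ℝ := fun i => b.repr (X (b i)) i
  have pairing_diag {a : Arrow (Fin n)} (ha : a ∈ arrows (lieCoeff b)) : a.pairing d = 0 :=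
    sub_eq_zero.2 (hb.repr_derivation_diag X (mem_arrows.1 ha).2)
  have orthogonal : ∑ i, (1 - v i) * d i = 0 := by
    simp only [← hx, Finset.sum_mul]
    rw [Finset.sum_comm]
    refine Finset.sum_eq_zero fun a ha => ?_
    simp only [mul_assoc, ← Finset.mul_sum, Arrow.sum_root_mul, pairing_diag ha, mul_zero]
  simp only [sub_mul, one_mul, Finset.sum_sub_distrib] at orthogonal
  exact (sub_eq_zero.1 orthogonal).symm

lemma IsDiagonalNikolayevsky.sum_mul_eq {v w : Fin n → ℝ} (hv : IsDiagonalNikolayevsky b v)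
    (hw : IsDiagonalNikolayevsky b w) : ∑ i, v i * w i = ∑ i, w i := by
  obtain ⟨N, hN, -, htrace⟩ := hv
  obtain ⟨N', hN', -⟩ := hw
  have := htrace N'
  rw [hN, hN', trace_diagOp_comp, trace_eq_sum_repr b] at this
  simpa [diagOp_basis] using this

lemma IsDiagonalNikolayevsky.unique {v w : Fin n → ℝ} (hv : IsDiagonalNikolayevsky b v)
    (hw : IsDiagonalNikolayevsky b w) : v = w := by
  have sum_sq : ∑ i, (v i - w i) ^ 2 = 0 := by
    calc ∑ i, (v i - w i) ^ 2
        = ∑ i, v i * v i - ∑ i, v i * w i - ∑ i, w i * v i + ∑ i, w i * w i := by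
          rw [← Finset.sum_sub_distrib, ← Finset.sum_sub_distrib, ← Finset.sum_add_distrib]
          exact Finset.sum_congr rfl fun i _ => by ring
      _ = 0 := by
          rw [hv.sum_mul_eq hv, hv.sum_mul_eq hw, hw.sum_mul_eq hv, hw.sum_mul_eq hw]
          ring
  rw [Finset.sum_eq_zero_iff_of_nonneg fun i _ => sq_nonneg _] at sum_sq
  exact funext fun i => sub_eq_zero.1 (pow_eq_zero_iff two_ne_zero |>.1
    (sum_sq i (Finset.mem_univ i)))

end Nikolayevsky

/-! ### Rescaled and reindexed bases -/

/-- The basis `b'` is obtained from `b` by the relabelling `e` and the rescaling `c`. -/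
structure IsRescaling {K V ι κ : Type*} [Field K] [AddCommGroup V] [Module K V]
    (b : Basis κ K V) (b' : Basis ι K V) (e : ι ≃ κ) (c : ι → K) : Prop where
  ne_zero : ∀ i, c i ≠ 0
  apply_eq : ∀ i, b' i = c i • b (e i)

namespace IsRescaling

section Basic

variable {K V ι κ : Type*} [Field K] [AddCommGroup V] [Module K V] {b : Basis κ K V}
  {b' : Basis ι K V} {e : ι ≃ κ} {c : ι → K}

lemma unitsSMul_reindex (b : Basis κ K V) (e : ι ≃ κ) (c : ι → Kˣ) :
    IsRescaling b ((b.reindex e.symm).unitsSMul c) e (fun i => c i) where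
  ne_zero i := (c i).ne_zero
  apply_eq i := by
    rw [Basis.unitsSMul_apply, Basis.reindex_apply, Equiv.symm_symm, Units.smul_def]

lemma reindex (b : Basis κ K V) (e : ι ≃ κ) : IsRescaling b (b.reindex e.symm) e 1 where
  ne_zero _ := one_ne_zero
  apply_eq i := by rw [Basis.reindex_apply, Equiv.symm_symm, Pi.one_apply, one_smul]

lemma symm (h : IsRescaling b b' e c) :
    IsRescaling b' b e.symm (fun k => (c (e.symm k))⁻¹) where
  ne_zero k := inv_ne_zero (h.ne_zero _)
  apply_eq k := by
    rw [h.apply_eq, smul_smul, inv_mul_cancel₀ (h.ne_zero _), one_smul, e.apply_symm_apply]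

lemma repr_eq (h : IsRescaling b b' e c) (x : V) (i : ι) :
    b'.repr x i = b.repr x (e i) / c i := by
  classical
  rw [eq_div_iff (h.ne_zero i), mul_comm]
  suffices c i • b'.coord i = b.coord (e i) from congrArg (fun f => f x) this
  refine b'.ext fun j => ?_
  rw [LinearMap.smul_apply, b'.coord_apply, b'.repr_self, b.coord_apply, h.apply_eq j, map_smul,
    b.repr_self]
  by_cases hij : j = i
  · simp [hij]
  · simp [hij, e.injective.ne hij]

end Basic

section LieCoeff

variable {K L ι κ : Type*} [Field K] [LieRing L] [LieAlgebra K L] {b : Basis κ K L}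
  {b' : Basis ι K L} {e : ι ≃ κ} {c : ι → K}

lemma lieCoeff_eq (h : IsRescaling b b' e c) (i j k : ι) :
    lieCoeff b' i j k = lieCoeff b (e i) (e j) (e k) / Arrow.ratio ⟨i, j, k⟩ c := by
  rw [lieCoeff, h.repr_eq, h.apply_eq, h.apply_eq, smul_lie, lie_smul, smul_smul, map_smul,
    Finsupp.smul_apply, lieCoeff, smul_eq_mul, Arrow.ratio, div_div_eq_mul_div, mul_comm]

lemma lieCoeff_ne_zero_iff (h : IsRescaling b b' e c) (i j k : ι) :
    lieCoeff b' i j k ≠ 0 ↔ lieCoeff b (e i) (e j) (e k) ≠ 0 := by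
  rw [h.lieCoeff_eq, Arrow.ratio, ne_eq, ne_eq, div_eq_zero_iff, or_iff_left]
  exact div_ne_zero (h.ne_zero k) (mul_ne_zero (h.ne_zero i) (h.ne_zero j))

lemma isNiceTensor (h : IsRescaling b b' e c) (hb : IsNiceTensor (lieCoeff b)) :
    IsNiceTensor (lieCoeff b') where
  tgt_unique i j k k' hk hk' := e.injective <|
    hb.tgt_unique ((h.lieCoeff_ne_zero_iff i j k).1 hk) ((h.lieCoeff_ne_zero_iff i j k').1 hk')
  src_unique i j j' k hj hj' := e.injective <|
    hb.src_unique ((h.lieCoeff_ne_zero_iff i j k).1 hj) ((h.lieCoeff_ne_zero_iff i j' k).1 hj')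

end LieCoeff

section Real

variable {L : Type*} [LieRing L] [LieAlgebra ℝ L] {m n : ℕ} {b : Basis (Fin n) ℝ L}
  {b' : Basis (Fin m) ℝ L} {e : Fin m ≃ Fin n} {c : Fin m → ℝ}

lemma isNice_iff (h : IsRescaling b b' e c) : IsNice b' ↔ IsNice b := by
  rw [NiceNilsoliton.isNice_iff, NiceNilsoliton.isNice_iff]
  exact ⟨h.symm.isNiceTensor, h.isNiceTensor⟩

lemma isIrreducible (h : IsRescaling b b' e c) (hb : IsIrreducible b) : IsIrreducible b' := by
  rw [isIrreducible_iff] at hb ⊢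
  intro s hs hne
  have preimage_eq := hb (e.symm ⁻¹' s)
    (fun i j k hijk => hs _ _ _ ((h.lieCoeff_ne_zero_iff _ (e.symm j) _).2 (by simpa using hijk)))
    (hne.preimage e.symm.surjective)
  exact e.symm.surjective.preimage_injective (preimage_eq.trans Set.preimage_univ.symm)

lemma isIrreducible_iff (h : IsRescaling b b' e c) : IsIrreducible b' ↔ IsIrreducible b :=
  ⟨h.symm.isIrreducible, h.isIrreducible⟩

lemma diagOp_eq (h : IsRescaling b b' e c) (v : Fin n → ℝ) :
    diagOp b' (v ∘ e) = diagOp b v := by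
  refine b'.ext fun i => ?_
  rw [diagOp_basis, h.apply_eq, map_smul, diagOp_basis, smul_comm, Function.comp_apply]

lemma diagMetric_eq (h : IsRescaling b b' e c) (g : Fin n → ℝ) :
    diagMetric b' (fun i => g (e i) * c i ^ 2) = diagMetric b g := by
  refine LinearMap.ext fun x => LinearMap.ext fun y => ?_
  rw [diagMetric_apply, diagMetric_apply]
  refine Fintype.sum_equiv e _ _ fun i => ?_
  rw [h.repr_eq, h.repr_eq]
  have := h.ne_zero i
  field_simp

lemma isDiagonalNikolayevsky_iff (h : IsRescaling b b' e c) (v : Fin n → ℝ) :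
    IsDiagonalNikolayevsky b' (v ∘ e) ↔ IsDiagonalNikolayevsky b v := by
  simp only [IsDiagonalNikolayevsky, h.diagOp_eq]

lemma isNormalizedNilsoliton (h : IsRescaling b b' e c) {g : Fin n → ℝ}
    (hg : IsNormalizedNilsoliton b g) :
    IsNormalizedNilsoliton b' (fun i => g (e i) * c i ^ 2) := by
  obtain ⟨v, hv, hv0, hric⟩ := hg
  refine ⟨v ∘ e, (h.isDiagonalNikolayevsky_iff v).2 hv, fun h0 => hv0 ?_, ?_⟩
  · exact e.surjective.injective_comp_right h0
  · rwa [h.diagMetric_eq, h.diagOp_eq]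

lemma map_mem_signatures (h : IsRescaling b b' e c) {s : Finset (Fin n)}
    (hs : s ∈ signatures b) : s.map e.symm.toEmbedding ∈ signatures b' := by
  obtain ⟨g, hg, hgs, hnil⟩ := hs
  have c_sq_pos (i : Fin m) : 0 < c i ^ 2 := sq_pos_iff.2 (h.ne_zero i)
  refine ⟨_, fun i => mul_ne_zero (hg (e i)) (c_sq_pos i).ne', fun i => ?_,
    h.isNormalizedNilsoliton hnil⟩
  rw [← zero_mul (c i ^ 2), mul_lt_mul_iff_left₀ (c_sq_pos i), ← hgs, Finset.mem_map_equiv,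
    Equiv.symm_symm]

lemma signatures_eq_image (h : IsRescaling b b' e c) :
    signatures b = (fun s => s.map e.toEmbedding) '' signatures b' := by
  ext s
  constructor
  · intro hs
    exact ⟨_, h.map_mem_signatures hs, by simp [Finset.map_map]⟩
  · rintro ⟨s', hs', rfl⟩
    exact h.symm.map_mem_signatures hs'

end Real

end IsRescaling

/-! ### Monomial equations -/

namespace Arrow

variable {K ι : Type*} [Field K] (a : Arrow ι)

lemma ratio_ne_zero {t : ι → K} (ht : ∀ h, t h ≠ 0) : a.ratio t ≠ 0 :=
  div_ne_zero (ht _) (mul_ne_zero (ht _) (ht _))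

lemma ratio_mul (s t : ι → K) : a.ratio (fun h => s h * t h) = a.ratio s * a.ratio t := by
  rw [ratio, mul_mul_mul_comm, mul_div_mul_comm, ratio, ratio]

lemma ratio_prod {κ : Type*} (S : Finset κ) (t : κ → ι → K) :
    a.ratio (fun h => ∏ s ∈ S, t s h) = ∏ s ∈ S, a.ratio (t s) := by
  simp only [ratio, Finset.prod_div_distrib, Finset.prod_mul_distrib]

lemma ratio_zpow_neg {x : K} (hx : x ≠ 0) (p : ι → ℤ) :
    a.ratio (fun h => x ^ (-p h)) = x ^ a.pairing p := by
  rw [ratio, ← zpow_add₀ hx, ← zpow_sub₀ hx, pairing]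
  congr 1
  ring

lemma ratio_eq_prod_zpow [Fintype ι] [DecidableEq ι] {t : ι → K} (ht : ∀ h, t h ≠ 0) :
    a.ratio t = ∏ h, t h ^ (-a.root ℤ h) := by
  have prod_single (i : ι) : ∏ h, t h ^ (Pi.single h 1 : ι → ℤ) i = t i := by
    rw [Finset.prod_eq_single i (fun h _ hh => by rw [Pi.single_eq_of_ne hh.symm, zpow_zero])
      (by simp), Pi.single_eq_same, zpow_one]
  have factor (h : ι) : t h ^ (-a.root ℤ h) = t h ^ (Pi.single h 1 : ι → ℤ) a.tgt /
      (t h ^ (Pi.single h 1 : ι → ℤ) a.src₁ * t h ^ (Pi.single h 1 : ι → ℤ) a.src₂) := by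
    rw [← zpow_add₀ (ht h), ← zpow_sub₀ (ht h), root, pairing, neg_sub]
  simp only [factor, Finset.prod_div_distrib, Finset.prod_mul_distrib, prod_single, ratio]

end Arrow

section IsDual

variable {ι : Type*} [DecidableEq ι]

/-- Integer vectors `P a` which are, up to the common factor `d`, dual to the incidence vectors of
the arrows in `S`. They witness the linear independence of the incidence vectors and solve
monomial equations explicitly. -/
structure IsDual (S : Finset (Arrow ι)) (P : Arrow ι → ι → ℤ) (d : ℤ) : Prop where
  ne_zero : d ≠ 0
  pairing_eq : ∀ a ∈ S, ∀ a' ∈ S, a'.pairing (P a) = if a = a' then d else 0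

namespace IsDual

variable {S : Finset (Arrow ι)} {P : Arrow ι → ι → ℤ} {d : ℤ}

lemma ratio_prod_zpow {K : Type*} [Field K] (hP : IsDual S P d) {y : Arrow ι → K}
    (hy : ∀ a ∈ S, y a ≠ 0) {a : Arrow ι} (ha : a ∈ S) :
    a.ratio (fun h => ∏ s ∈ S, y s ^ (-P s h)) = y a ^ d := by
  have factor (s : Arrow ι) (hs : s ∈ S) :
      a.ratio (fun h => y s ^ (-P s h)) = if s = a then y s ^ d else 1 := by
    rw [Arrow.ratio_zpow_neg a (hy s hs), hP.pairing_eq s hs a ha]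
    split_ifs <;> simp
  rw [Arrow.ratio_prod, Finset.prod_congr rfl factor, Finset.prod_ite_eq', if_pos ha]

lemma exists_ne_zero {K : Type*} [Field K] (hP : IsDual S P 1) {y : Arrow ι → K}
    (hy : ∀ a ∈ S, y a ≠ 0) :
    ∃ t : ι → K, (∀ h, t h ≠ 0) ∧ ∀ a ∈ S, a.ratio t = y a :=
  ⟨fun h => ∏ s ∈ S, y s ^ (-P s h),
    fun _ => Finset.prod_ne_zero_iff.2 fun s hs => zpow_ne_zero _ (hy s hs),
    fun _ ha => (hP.ratio_prod_zpow hy ha).trans (zpow_one _)⟩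

lemma exists_pos (hP : IsDual S P d) {y : Arrow ι → ℝ} (hy : ∀ a ∈ S, 0 < y a) :
    ∃ t : ι → ℝ, (∀ h, 0 < t h) ∧ ∀ a ∈ S, a.ratio t = y a := by
  have root_pos (a : Arrow ι) (ha : a ∈ S) : 0 < y a ^ (d : ℝ)⁻¹ := Real.rpow_pos_of_pos (hy a ha) _
  refine ⟨fun h => ∏ s ∈ S, (y s ^ (d : ℝ)⁻¹) ^ (-P s h),
    fun _ => Finset.prod_pos fun s hs => zpow_pos (root_pos s hs) _, fun a ha => ?_⟩
  rw [hP.ratio_prod_zpow (fun s hs => (root_pos s hs).ne') ha, ← Real.rpow_intCast,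
    Real.rpow_inv_rpow (hy a ha).le (Int.cast_ne_zero.2 hP.ne_zero)]

/-- When only a multiple of the incidence vector of `a₀` can be completed to a dual system, the
equation for `a₀` can be solved up to sign. -/
lemma exists_up_to_sign {a₀ : Arrow ι} {P' : Arrow ι → ι → ℤ} (ha₀ : a₀ ∉ S)
    (hP : IsDual S P 1) (hP' : IsDual (insert a₀ S) P' d) {y : Arrow ι → ℝ}
    (hy : ∀ a ∈ insert a₀ S, y a ≠ 0) :
    ∃ t : ι → ℝ, (∀ h, t h ≠ 0) ∧ (∀ a ∈ S, a.ratio t = y a) ∧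
      (a₀.ratio t = y a₀ ∨ a₀.ratio t = -y a₀) := by
  obtain ⟨t, ht, ht_ratio⟩ := hP.exists_ne_zero fun a ha => hy a (Finset.mem_insert_of_mem ha)
  have hr : a₀.ratio t ≠ 0 := a₀.ratio_ne_zero ht
  have hy₀ : y a₀ ≠ 0 := hy _ (Finset.mem_insert_self _ _)
  obtain ⟨s, hs, hs_ratio⟩ := hP'.exists_pos
    (y := fun a => if a = a₀ then |y a₀ / a₀.ratio t| else 1) (fun a _ => by
      split_ifs
      · exact abs_pos.2 (div_ne_zero hy₀ hr)
      · exact one_pos)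
  refine ⟨fun h => t h * s h, fun h => mul_ne_zero (ht h) (hs h).ne', fun a ha => ?_, ?_⟩
  · rw [Arrow.ratio_mul, ht_ratio a ha, hs_ratio a (Finset.mem_insert_of_mem ha),
      if_neg (ne_of_mem_of_not_mem ha ha₀), mul_one]
  · rw [Arrow.ratio_mul, hs_ratio a₀ (Finset.mem_insert_self _ _), if_pos rfl]
    rcases abs_choice (y a₀ / a₀.ratio t) with h | h
    · left; rw [h, mul_div_cancel₀ _ hr]
    · right; rw [h, mul_neg, mul_div_cancel₀ _ hr]

lemma exists_insert {a₀ : Arrow ι} (ha₀ : a₀ ∉ S) (hP : IsDual S P d) {p : ι → ℤ}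
    (hp : ∀ a ∈ S, a.pairing p = 0) (hp₀ : a₀.pairing p ≠ 0) :
    ∃ P', IsDual (insert a₀ S) P' (d * a₀.pairing p) := by
  let Q (a : Arrow ι) (h : ι) : ℤ :=
    if a = a₀ then d * p h else a₀.pairing p * P a h - a₀.pairing (P a) * p h
  have pairing_a₀ (a' : Arrow ι) : a'.pairing (Q a₀) = d * a'.pairing p := by
    simp only [Q, if_true, Arrow.pairing]
    ring
  have pairing_ne {a : Arrow ι} (a' : Arrow ι) (ha : a ≠ a₀) :
      a'.pairing (Q a) = a₀.pairing p * a'.pairing (P a) - a₀.pairing (P a) * a'.pairing p := by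
    simp only [Q, if_neg ha, Arrow.pairing]
    ring
  refine ⟨Q, mul_ne_zero hP.ne_zero hp₀, fun a ha a' ha' => ?_⟩
  rcases Finset.mem_insert.1 ha with rfl | haS
  · rw [pairing_a₀]
    rcases Finset.mem_insert.1 ha' with rfl | haS'
    · rw [if_pos rfl]
    · rw [hp a' haS', mul_zero, if_neg (ne_of_mem_of_not_mem haS' ha₀).symm]
  · rw [pairing_ne a' (ne_of_mem_of_not_mem haS ha₀)]
    rcases Finset.mem_insert.1 ha' with rfl | haS'
    · rw [if_neg (ne_of_mem_of_not_mem haS ha₀)]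
      ring
    · rw [hP.pairing_eq a haS a' haS', hp a' haS']
      split_ifs <;> ring

end IsDual

end IsDual

section IsRigid

variable {ι : Type*} [Finite ι] [DecidableEq ι]

/-- The system `∑ x_a root_a = ∑ lam_a root_a`, where `x_a = g_k / (g_i g_j)` is the monomial of
the arrow `a`, has positive solutions `g`, and all its solutions satisfy `x = lam`. -/
structure IsRigid (A : Finset (Arrow ι)) (lam : Arrow ι → ℝ) : Prop where
  ratio_eq : ∀ g : ι → ℝ, (∀ i, g i ≠ 0) →
    (∀ h, ∑ a ∈ A, a.ratio g * a.root ℝ h = ∑ a ∈ A, lam a * a.root ℝ h) →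
    ∀ a ∈ A, a.ratio g = lam a
  exists_pos : ∃ g : ι → ℝ, (∀ i, 0 < g i) ∧ ∀ a ∈ A, a.ratio g = lam a

variable {S : Finset (Arrow ι)} {P : Arrow ι → ι → ℤ} {d : ℤ}

lemma sum_mul_pairing_eq_zero {z : Arrow ι → ℝ} (hz : ∀ h, ∑ a ∈ S, z a * a.root ℝ h = 0)
    (p : ι → ℤ) : ∑ a ∈ S, z a * (a.pairing p : ℤ) = 0 := by
  cases nonempty_fintype ι
  have sum_zero : ∑ h, (∑ a ∈ S, z a * a.root ℝ h) * (p h : ℝ) = 0 := by simp [hz]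
  simp only [Finset.sum_mul] at sum_zero
  rw [Finset.sum_comm] at sum_zero
  rw [← sum_zero]
  refine Finset.sum_congr rfl fun a _ => ?_
  simp only [mul_assoc, ← Finset.mul_sum, Arrow.sum_root_mul, Arrow.pairing]
  push_cast
  rfl

lemma IsDual.eq_zero (hP : IsDual S P d) {z : Arrow ι → ℝ}
    (hz : ∀ h, ∑ a ∈ S, z a * a.root ℝ h = 0) {a : Arrow ι} (ha : a ∈ S) : z a = 0 := by
  have sum_eq : ∑ s ∈ S, z s * (s.pairing (P a) : ℤ) = z a * d := by
    rw [Finset.sum_congr rfl fun s hs => by rw [hP.pairing_eq a ha s hs]]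
    simp [ha]
  rw [sum_mul_pairing_eq_zero hz] at sum_eq
  exact (mul_eq_zero.1 sum_eq.symm).resolve_right (Int.cast_ne_zero.2 hP.ne_zero)

lemma IsDual.isRigid (hP : IsDual S P d) {lam : Arrow ι → ℝ} (hlam : ∀ a ∈ S, 0 < lam a) :
    IsRigid S lam where
  ratio_eq g _ hg a ha := sub_eq_zero.1 <|
    hP.eq_zero (z := fun a => a.ratio g - lam a)
      (fun h => by simp only [sub_mul, Finset.sum_sub_distrib, hg h, sub_self]) ha
  exists_pos := hP.exists_pos hlam

/-- The incidence vector of `a₀` depends on those of the arrows in `S` by a relation of the form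
`a₀ + a₁ = a₂ + a₃`. A Jacobi identity with two nonzero terms gives rise to such a relation
between the four arrows involved. -/
structure IsParallelogram (S : Finset (Arrow ι)) (a₀ a₁ a₂ a₃ : Arrow ι) : Prop where
  notMem : a₀ ∉ S
  mem₁ : a₁ ∈ S
  mem₂ : a₂ ∈ S
  mem₃ : a₃ ∈ S
  ne₁₂ : a₁ ≠ a₂
  ne₁₃ : a₁ ≠ a₃
  ne₂₃ : a₂ ≠ a₃
  root_add : ∀ h, a₀.root ℤ h + a₁.root ℤ h = a₂.root ℤ h + a₃.root ℤ h

namespace IsParallelogram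

variable {a₀ a₁ a₂ a₃ : Arrow ι} (hq : IsParallelogram S a₀ a₁ a₂ a₃)
include hq

lemma ratio_mul_ratio {K : Type*} [Field K] {t : ι → K} (ht : ∀ i, t i ≠ 0) :
    a₀.ratio t * a₁.ratio t = a₂.ratio t * a₃.ratio t := by
  cases nonempty_fintype ι
  simp only [Arrow.ratio_eq_prod_zpow _ ht, ← Finset.prod_mul_distrib, ← zpow_add₀ (ht _),
    ← neg_add, hq.root_add]

lemma ratio_eq {K : Type*} [Field K] {t : ι → K} (ht : ∀ i, t i ≠ 0) {y : Arrow ι → K}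
    (hy : ∀ a ∈ S, a.ratio t = y a) (hy₁ : y a₁ ≠ 0) (hmul : y a₀ * y a₁ = y a₂ * y a₃) :
    a₀.ratio t = y a₀ := by
  refine mul_right_cancel₀ hy₁ ?_
  rw [hmul, ← hy _ hq.mem₁, ← hy _ hq.mem₂, ← hy _ hq.mem₃, hq.ratio_mul_ratio ht]

lemma pairing_add_pairing (p : ι → ℤ) :
    a₀.pairing p + a₁.pairing p = a₂.pairing p + a₃.pairing p := by
  cases nonempty_fintype ι
  simp only [← Arrow.sum_root_mul, ← Finset.sum_add_distrib, ← add_mul, hq.root_add]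

lemma eq_mul_of_sum_root (hP : IsDual S P d) {z : Arrow ι → ℝ}
    (hz : ∀ h, ∑ a ∈ insert a₀ S, z a * a.root ℝ h = 0) {a : Arrow ι} (ha : a ∈ S) :
    z a = z a₀ * ((if a = a₁ then 1 else 0) - (if a = a₂ then 1 else 0)
      - (if a = a₃ then 1 else 0)) := by
  have sum_pairing := sum_mul_pairing_eq_zero hz (P a)
  rw [Finset.sum_insert hq.notMem,
    Finset.sum_congr rfl fun s hs => by rw [hP.pairing_eq a ha s hs]] at sum_pairing
  have pairing_add := hq.pairing_add_pairing (P a)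
  rw [hP.pairing_eq a ha _ hq.mem₁, hP.pairing_eq a ha _ hq.mem₂,
    hP.pairing_eq a ha _ hq.mem₃] at pairing_add
  have pairing_a₀ : ((a₀.pairing (P a) : ℤ) : ℝ) = d * ((if a = a₂ then 1 else 0)
      + (if a = a₃ then 1 else 0) - (if a = a₁ then 1 else 0)) := by
    rw [eq_sub_of_add_eq pairing_add]
    push_cast
    simp only [mul_add, mul_sub, mul_ite, mul_one, mul_zero]
  have hd : (d : ℝ) ≠ 0 := Int.cast_ne_zero.2 hP.ne_zero
  simp only [Int.cast_ite, Int.cast_zero, mul_ite, mul_zero, Finset.sum_ite_eq, ha, if_true,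
    pairing_a₀] at sum_pairing
  refine mul_right_cancel₀ hd ?_
  linear_combination sum_pairing

/-- The system determines the monomials up to a multiple `z` of the relation `a₀ + a₁ = a₂ + a₃`,
and the multiplicative form of this relation becomes a linear equation for `z`. -/
lemma isRigid (hP : IsDual S P d) {lam : Arrow ι → ℝ} (hpos : ∀ a ∈ insert a₀ S, 0 < lam a)
    (hlam : lam a₀ * lam a₁ = lam a₂ * lam a₃) : IsRigid (insert a₀ S) lam where
  ratio_eq g hg h := by
    have eq_mul {a : Arrow ι} (ha : a ∈ S) := hq.eq_mul_of_sum_root hP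
      (z := fun a => a.ratio g - lam a)
      (fun k => by simp only [sub_mul, Finset.sum_sub_distrib, h k, sub_self]) ha
    set z : ℝ := a₀.ratio g - lam a₀ with hz
    have ratio₁ := eq_mul hq.mem₁
    have ratio₂ := eq_mul hq.mem₂
    have ratio₃ := eq_mul hq.mem₃
    simp only [if_true, if_neg hq.ne₁₂, if_neg hq.ne₁₃, if_neg hq.ne₁₂.symm, if_neg hq.ne₁₃.symm,
      if_neg hq.ne₂₃, if_neg hq.ne₂₃.symm] at ratio₁ ratio₂ ratio₃
    have mul_sum_eq_zero : z * (lam a₀ + lam a₁ + lam a₂ + lam a₃) = 0 := by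
      have mul_eq := hq.ratio_mul_ratio hg
      rw [eq_add_of_sub_eq hz.symm, eq_add_of_sub_eq ratio₁, eq_add_of_sub_eq ratio₂,
        eq_add_of_sub_eq ratio₃] at mul_eq
      linear_combination mul_eq - hlam
    have lam_pos₀ := hpos _ (Finset.mem_insert_self _ _)
    have lam_pos₁ := hpos _ (Finset.mem_insert_of_mem hq.mem₁)
    have lam_pos₂ := hpos _ (Finset.mem_insert_of_mem hq.mem₂)
    have lam_pos₃ := hpos _ (Finset.mem_insert_of_mem hq.mem₃)
    have z_eq_zero : z = 0 := (mul_eq_zero.1 mul_sum_eq_zero).resolve_right (by positivity)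
    refine (Finset.forall_mem_insert _ _ _).2 ⟨sub_eq_zero.1 z_eq_zero, fun a ha => ?_⟩
    exact sub_eq_zero.1 (by rw [eq_mul ha, z_eq_zero, zero_mul])
  exists_pos := by
    obtain ⟨g, hg, ratio_eq⟩ := hP.exists_pos fun a ha => hpos a (Finset.mem_insert_of_mem ha)
    exact ⟨g, hg, (Finset.forall_mem_insert _ _ _).2 ⟨hq.ratio_eq (fun i => (hg i).ne') ratio_eq
      (hpos _ (Finset.mem_insert_of_mem hq.mem₁)).ne' hlam, ratio_eq⟩⟩

end IsParallelogram

end IsRigid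

/-! ### Signatures -/

/-- An even number of the three ends of the arrow lies in `s`. -/
def Arrow.IsBalanced {ι : Type*} (a : Arrow ι) (s : Finset ι) : Prop :=
  a.tgt ∈ s ↔ (a.src₁ ∈ s ↔ a.src₂ ∉ s)

instance {ι : Type*} [DecidableEq ι] (a : Arrow ι) (s : Finset ι) : Decidable (a.IsBalanced s) :=
  inferInstanceAs (Decidable (a.tgt ∈ s ↔ (a.src₁ ∈ s ↔ a.src₂ ∉ s)))

lemma Arrow.ratio_pos_iff {ι : Type*} {g : ι → ℝ} (hg : ∀ i, g i ≠ 0) {s : Finset ι}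
    (hs : ∀ i, i ∈ s ↔ g i < 0) (a : Arrow ι) : 0 < a.ratio g ↔ a.IsBalanced s := by
  have pos_iff (i : ι) : 0 < g i ↔ i ∉ s := by
    rw [hs, not_lt, le_iff_lt_or_eq, or_iff_left (hg i).symm]
  simp only [ratio, IsBalanced, div_pos_iff, mul_pos_iff, mul_neg_iff, pos_iff, ← hs]
  tauto

lemma Arrow.IsBalanced.ratio_sign {K ι : Type*} [Field K] [DecidableEq ι] {a : Arrow ι}
    {s : Finset ι} (ha : a.IsBalanced s) :
    a.ratio (fun i => if i ∈ s then (-1 : K) else 1) = 1 := by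
  unfold IsBalanced at ha
  by_cases h₁ : a.src₁ ∈ s <;> by_cases h₂ : a.src₂ ∈ s <;> simp [ratio, ha, h₁, h₂]

section IsRigid

variable {ι : Type*} [DecidableEq ι] {A : Finset (Arrow ι)} {lam : Arrow ι → ℝ}

lemma IsRigid.pos (h : IsRigid A lam) {a : Arrow ι} (ha : a ∈ A) : 0 < lam a := by
  obtain ⟨g, hg, ratio_eq⟩ := h.exists_pos
  rw [← ratio_eq a ha]
  exact div_pos (hg _) (mul_pos (hg _) (hg _))

lemma IsRigid.exists_of_isBalanced (h : IsRigid A lam) {s : Finset ι}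
    (hs : ∀ a ∈ A, a.IsBalanced s) :
    ∃ g : ι → ℝ, (∀ i, g i ≠ 0) ∧ (∀ i, i ∈ s ↔ g i < 0) ∧ ∀ a ∈ A, a.ratio g = lam a := by
  obtain ⟨g, hg, ratio_eq⟩ := h.exists_pos
  refine ⟨fun i => (if i ∈ s then -1 else 1) * g i, fun i => ?_, fun i => ?_, fun a ha => ?_⟩
  · simp only [ne_eq, mul_eq_zero, (hg i).ne', or_false]
    split_ifs <;> norm_num
  · simp only [mul_neg_iff, hg i, (hg i).not_gt, and_false, false_or, and_true]
    split_ifs with hi <;> simp [hi]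
  · rw [Arrow.ratio_mul, (hs a ha).ratio_sign, one_mul, ratio_eq a ha]

end IsRigid

theorem signatures_eq_of_isRigid {L : Type*} [LieRing L] [LieAlgebra ℝ L] {n : ℕ}
    {b : Basis (Fin n) ℝ L} (hb : IsNiceTensor (lieCoeff b)) (hb' : IsTriangular (lieCoeff b))
    (hsq : ∀ i j k, lieCoeff b i j k ≠ 0 → lieCoeff b i j k ^ 2 = 1) {v : Fin n → ℝ} (hv : v ≠ 0)
    (hN : IsDiagonalNikolayevsky b v) {lam : Arrow (Fin n) → ℝ}
    (hsum : ∀ h, ∑ a ∈ arrows (lieCoeff b), lam a * a.root ℝ h = 1 - v h)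
    (hr : IsRigid (arrows (lieCoeff b)) lam) :
    signatures b = {s | ∀ a ∈ arrows (lieCoeff b), a.IsBalanced s} := by
  have isRicciOperator_iff (g : Fin n → ℝ) (hg : ∀ i, g i ≠ 0) :
      IsRicciOperator (diagMetric b g)
        (-(1 / 2 : ℝ) • (1 : Module.End ℝ L) + (1 / 2 : ℝ) • diagOp b v) ↔
      ∀ h, ∑ a ∈ arrows (lieCoeff b), a.ratio g * a.root ℝ h
        = ∑ a ∈ arrows (lieCoeff b), lam a * a.root ℝ h := by
    rw [isRicciOperator_nilsoliton_iff hb hb' hg]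
    refine forall_congr' fun h => ?_
    rw [hsum]
    refine Eq.congr (Finset.sum_congr rfl fun a ha => ?_) rfl
    rw [Arrow.coeff, hsq _ _ _ (mem_arrows.1 ha).2, one_mul]
  ext s
  constructor
  · rintro ⟨g, hg, hs, v', hv', -, hric⟩ a ha
    obtain rfl := hv'.unique hN
    rw [← Arrow.ratio_pos_iff hg hs, hr.ratio_eq g hg ((isRicciOperator_iff g hg).1 hric) a ha]
    exact hr.pos ha
  · intro hs
    obtain ⟨g, hg, neg_iff, ratio_eq⟩ := hr.exists_of_isBalanced hs
    refine ⟨g, hg, neg_iff, v, hN, hv, (isRicciOperator_iff g hg).2 fun h => ?_⟩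
    exact Finset.sum_congr rfl fun a ha => by rw [ratio_eq a ha]

/-! ### Lie tensors -/

section LieTensor

variable {R ι : Type*}

/-- A tensor alternating in its first two indices. -/
structure IsAlternatingTensor [AddGroup R] (c : ι → ι → ι → R) : Prop where
  self : ∀ i k, c i i k = 0
  skew : ∀ i j k, c j i k = -c i j k

/-- The component along `e_u` of the Jacobi sum `[[e_i, e_j], e_k] + [[e_j, e_k], e_i] +
[[e_k, e_i], e_j]`, in terms of the structure constants. -/
def jacobiator [NonUnitalNonAssocSemiring R] [Fintype ι] (c : ι → ι → ι → R) (i j k u : ι) : R :=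
  ∑ w, (c i j w * c w k u + c j k w * c w i u + c k i w * c w j u)

/-- The component along `e_u` of the Jacobi identity for `e_x`, `e_y`, `e_z` has exactly two nonzero
terms, through `[e_x, e_y]`, a multiple of `e_w`, and `[e_y, e_z]`, a multiple of `e_w'`. -/
structure IsTwoTermJacobi [Zero R] (c : ι → ι → ι → R) (x y z w w' u : ι) : Prop where
  ne : x ≠ z
  ne_zero₀ : c x y w ≠ 0
  ne_zero₁ : c w z u ≠ 0
  ne_zero₂ : c y z w' ≠ 0
  ne_zero₃ : c w' x u ≠ 0
  eq_zero : ∀ p, c z x p ≠ 0 → c p y u = 0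

lemma IsTwoTermJacobi.of_ne_zero_iff {S : Type*} [Zero R] [Zero S] {c : ι → ι → ι → R}
    {d : ι → ι → ι → S} {x y z w w' u : ι} (h : IsTwoTermJacobi c x y z w w' u)
    (hcd : ∀ i j k, c i j k ≠ 0 ↔ d i j k ≠ 0) : IsTwoTermJacobi d x y z w w' u where
  ne := h.ne
  ne_zero₀ := (hcd _ _ _).1 h.ne_zero₀
  ne_zero₁ := (hcd _ _ _).1 h.ne_zero₁
  ne_zero₂ := (hcd _ _ _).1 h.ne_zero₂
  ne_zero₃ := (hcd _ _ _).1 h.ne_zero₃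
  eq_zero p hp := not_ne_iff.1 fun hp' => (hcd _ _ _).2 hp' (h.eq_zero p ((hcd _ _ _).2 hp))

/-- The axioms satisfied by the structure constants of a Lie algebra. -/
structure IsLieTensor [CommRing R] [Fintype ι] (c : ι → ι → ι → R) : Prop
    extends IsAlternatingTensor c where
  jacobi : ∀ i j k u, jacobiator c i j k u = 0

lemma isLieTensor_lieCoeff {L : Type*} [CommRing R] [LieRing L] [LieAlgebra R L] [Fintype ι]
    (b : Basis ι R L) : IsLieTensor (lieCoeff b) :=
  ⟨⟨lieCoeff_self b, lieCoeff_skew b⟩, lieCoeff_jacobi b⟩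

lemma jacobiator_rotate [NonUnitalNonAssocSemiring R] [Fintype ι] (c : ι → ι → ι → R)
    (i j k u : ι) : jacobiator c j k i u = jacobiator c i j k u :=
  Finset.sum_congr rfl fun w _ => by abel

lemma IsLieTensor.map {S : Type*} [CommRing R] [CommRing S] [Fintype ι] {c : ι → ι → ι → R}
    (hc : IsLieTensor c) (f : R →+* S) : IsLieTensor fun i j k => f (c i j k) where
  self i k := by rw [hc.self, map_zero]
  skew i j k := by rw [hc.skew, map_neg]
  jacobi i j k u := by simpa [jacobiator] using congrArg f (hc.jacobi i j k u)

namespace IsAlternatingTensor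

variable {c : ι → ι → ι → R}

lemma ne_zero_comm [AddGroup R] (hc : IsAlternatingTensor c) {i j k : ι} :
    c j i k ≠ 0 ↔ c i j k ≠ 0 := by
  rw [hc.skew, neg_ne_zero]

lemma ne_of_ne_zero [AddGroup R] (hc : IsAlternatingTensor c) {i j k : ι} (h : c i j k ≠ 0) :
    i ≠ j := by
  rintro rfl
  exact h (hc.self i k)

lemma jacobiator_swap [CommRing R] [Fintype ι] (hc : IsAlternatingTensor c) (i j k u : ι) :
    jacobiator c j i k u = -jacobiator c i j k u := by
  rw [jacobiator, jacobiator, ← Finset.sum_neg_distrib]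
  exact Finset.sum_congr rfl fun w _ => by
    rw [hc.skew i j w, hc.skew k i w, hc.skew j k w]
    ring

variable [DecidableEq R] [LinearOrder ι] [Fintype ι]

lemma forall_of_arrows [AddGroup R] (hc : IsAlternatingTensor c) {Q : ι → ι → ι → Prop}
    (hQ : ∀ i j k, Q i j k → Q j i k) (h : ∀ a ∈ arrows c, Q a.src₁ a.src₂ a.tgt)
    {i j k : ι} (hijk : c i j k ≠ 0) : Q i j k := by
  rcases (hc.ne_of_ne_zero hijk).lt_or_gt with hij | hji
  · exact h ⟨i, j, k⟩ (mem_arrows.2 ⟨hij, hijk⟩)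
  · exact hQ _ _ _ (h ⟨j, i, k⟩ (mem_arrows.2 ⟨hji, hc.ne_zero_comm.2 hijk⟩))

lemma isNiceTensor_of_arrows [AddGroup R] (hc : IsAlternatingTensor c)
    (h : ∀ a ∈ arrows c, (∀ k, c a.src₁ a.src₂ k ≠ 0 → k = a.tgt) ∧
      (∀ j, c a.src₁ j a.tgt ≠ 0 → j = a.src₂) ∧ ∀ i, c i a.src₂ a.tgt ≠ 0 → i = a.src₁) :
    IsNiceTensor c := by
  have unique {i j k : ι} (hijk : c i j k ≠ 0) := hc.forall_of_arrows
    (Q := fun i j k => (∀ k', c i j k' ≠ 0 → k' = k) ∧ (∀ j', c i j' k ≠ 0 → j' = j) ∧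
      ∀ i', c i' j k ≠ 0 → i' = i)
    (fun _ _ _ hQ => ⟨fun k' hk' => hQ.1 k' (hc.ne_zero_comm.1 hk'),
      fun i' hi' => hQ.2.2 i' (hc.ne_zero_comm.1 hi'),
      fun j' hj' => hQ.2.1 j' (hc.ne_zero_comm.1 hj')⟩) h hijk
  exact ⟨fun _ _ _ k' hk hk' => ((unique hk).1 k' hk').symm,
    fun _ _ j' _ hj hj' => ((unique hj).2.1 j' hj').symm⟩

lemma isLieTensor_of_arrows [CommRing R] (hc : IsAlternatingTensor c)
    (h : ∀ a ∈ arrows c, ∀ k u, c a.tgt k u ≠ 0 → jacobiator c a.src₁ a.src₂ k u = 0) :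
    IsLieTensor c := by
  have jacobi_of_ne_zero {i j k u w : ι} (hw : c i j w * c w k u ≠ 0) :
      jacobiator c i j k u = 0 :=
    hc.forall_of_arrows (Q := fun i j w => ∀ k u, c w k u ≠ 0 → jacobiator c i j k u = 0)
      (fun i j w hQ k u hu => by rw [hc.jacobiator_swap, hQ k u hu, neg_zero]) h
      (left_ne_zero_of_mul hw) k u (right_ne_zero_of_mul hw)
  refine ⟨hc, fun i j k u => ?_⟩
  by_contra hne
  refine hne (Finset.sum_eq_zero fun w _ => ?_)
  rw [not_not.1 (mt jacobi_of_ne_zero hne),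
    not_not.1 (mt jacobi_of_ne_zero (by rwa [jacobiator_rotate])),
    not_not.1 (mt jacobi_of_ne_zero (by rwa [← jacobiator_rotate])), add_zero, add_zero]

end IsAlternatingTensor

namespace IsLieTensor

variable [CommRing R] [Fintype ι] {c : ι → ι → ι → R} (hc : IsLieTensor c)
include hc

lemma mul_add_sum_eq_zero (hc' : IsNiceTensor c) {x y z w u : ι} (hw : c x y w ≠ 0)
    (hzx : ∀ p, c z x p * c p y u = 0) : c x y w * c w z u + ∑ p, c y z p * c p x u = 0 := by
  have jacobi := hc.jacobi x y z u
  simp only [jacobiator, hzx, add_zero, Finset.sum_add_distrib] at jacobi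
  rwa [Finset.sum_eq_single w (fun p _ hp => by
    rw [not_not.1 (mt (hc'.tgt_unique hw) hp.symm), zero_mul]) (by simp)] at jacobi

lemma mul_eq_zero_of_jacobi (hc' : IsNiceTensor c) {x y z w u : ι} (hw : c x y w ≠ 0)
    (hyz : ∀ p, c y z p * c p x u = 0) (hzx : ∀ p, c z x p * c p y u = 0) :
    c x y w * c w z u = 0 := by
  simpa [hyz] using hc.mul_add_sum_eq_zero hc' hw hzx

lemma mul_add_mul_eq_zero (hc' : IsNiceTensor c) {x y z w w' u : ι}
    (h : IsTwoTermJacobi c x y z w w' u) : c x y w * c w z u + c y z w' * c w' x u = 0 := by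
  have jacobi := hc.mul_add_sum_eq_zero hc' h.ne_zero₀ (u := u) (z := z) fun p => by
    by_cases hp : c z x p = 0
    · rw [hp, zero_mul]
    · rw [h.eq_zero p hp, mul_zero]
  rwa [Finset.sum_eq_single w' (fun p _ hp => by
    rw [not_not.1 (mt (hc'.tgt_unique h.ne_zero₂) hp.symm), zero_mul]) (by simp)] at jacobi

end IsLieTensor

end LieTensor

/-- The arrow with its sources in increasing order. -/
def Arrow.sorted {ι : Type*} [LinearOrder ι] (a : Arrow ι) : Arrow ι :=
  if a.src₁ ≤ a.src₂ then a else ⟨a.src₂, a.src₁, a.tgt⟩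

namespace Arrow

variable {ι R : Type*} [LinearOrder ι] (a : Arrow ι)

lemma sorted_eq_or : a.sorted = a ∨ a.sorted = ⟨a.src₂, a.src₁, a.tgt⟩ := by
  unfold sorted
  split_ifs <;> simp

lemma sorted_tgt : a.sorted.tgt = a.tgt := by rcases a.sorted_eq_or with h | h <;> rw [h]

lemma pairing_sorted [AddCommGroup R] (v : ι → R) : a.sorted.pairing v = a.pairing v := by
  rcases a.sorted_eq_or with ha | ha <;> simp only [ha, pairing, add_comm]

variable {a}

lemma sorted_eq_sorted {a' : Arrow ι} : a.sorted = a'.sorted ↔ a.tgt = a'.tgt ∧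
    (a.src₁ = a'.src₁ ∧ a.src₂ = a'.src₂ ∨ a.src₁ = a'.src₂ ∧ a.src₂ = a'.src₁) := by
  unfold sorted
  grind [Arrow]

end Arrow

namespace IsAlternatingTensor

variable {R ι : Type*} [AddGroup R] [DecidableEq R] [Fintype ι] [LinearOrder ι]
  {c : ι → ι → ι → R} (hc : IsAlternatingTensor c)
include hc

lemma sorted_mem_arrows {i j k : ι} : Arrow.sorted ⟨i, j, k⟩ ∈ arrows c ↔ c i j k ≠ 0 := by
  rw [mem_arrows]
  unfold Arrow.sorted
  split_ifs with hij
  · exact ⟨And.right, fun h => ⟨lt_of_le_of_ne hij (hc.ne_of_ne_zero h), h⟩⟩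
  · exact ⟨fun h => hc.ne_zero_comm.1 h.2, fun h => ⟨not_le.1 hij, hc.ne_zero_comm.2 h⟩⟩

lemma isParallelogram (hc' : IsTriangular c) {x y z w w' u : ι}
    (hJ : IsTwoTermJacobi c x y z w w' u) :
    IsParallelogram ((arrows c).erase (Arrow.sorted ⟨x, y, w⟩)) (Arrow.sorted ⟨x, y, w⟩)
      (Arrow.sorted ⟨w, z, u⟩) (Arrow.sorted ⟨y, z, w'⟩) (Arrow.sorted ⟨w', x, u⟩) := by
  have ne_of_tgt_ne {a a' : Arrow ι} (h : a.tgt ≠ a'.tgt) : a.sorted ≠ a'.sorted := fun h' =>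
    h (by rw [← a.sorted_tgt, h', a'.sorted_tgt])
  obtain ⟨hxz, h₀, h₁, h₂, h₃, -⟩ := hJ
  refine ⟨Finset.notMem_erase _ _,
    Finset.mem_erase.2 ⟨ne_of_tgt_ne (hc' h₁).1.ne', hc.sorted_mem_arrows.2 h₁⟩,
    Finset.mem_erase.2 ⟨fun h => ?_, hc.sorted_mem_arrows.2 h₂⟩,
    Finset.mem_erase.2 ⟨ne_of_tgt_ne (hc' h₁).1.ne', hc.sorted_mem_arrows.2 h₃⟩,
    ne_of_tgt_ne (hc' h₃).1.ne', fun h => ?_, ne_of_tgt_ne (hc' h₃).1.ne, fun h => ?_⟩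
  · rcases (Arrow.sorted_eq_sorted.1 h).2 with ⟨hyx, hzy⟩ | ⟨-, hzx⟩
    · exact hxz (hyx.symm.trans hzy.symm)
    · exact hxz hzx.symm
  · rcases (Arrow.sorted_eq_sorted.1 h).2 with ⟨-, hzx⟩ | ⟨hwx, -⟩
    · exact hxz hzx.symm
    · exact (hc' h₀).1.ne' hwx
  · simp only [Arrow.root, Arrow.pairing_sorted]
    simp only [Arrow.pairing]
    ring

end IsAlternatingTensor

section Connected

/-- The graph in which every arrow of `l` joins its sources to its target is connected (or empty).
-/
def IsConnectedDiagram {ι : Type*} [Fintype ι] (l : List (Arrow ι)) : Prop :=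
  ∀ s : Finset ι, (∀ a ∈ l, (a.src₁ ∈ s ↔ a.tgt ∈ s) ∧ (a.src₂ ∈ s ↔ a.tgt ∈ s)) →
    s.Nonempty → s = Finset.univ

instance {ι : Type*} [Fintype ι] [DecidableEq ι] (l : List (Arrow ι)) :
    Decidable (IsConnectedDiagram l) :=
  inferInstanceAs (Decidable (∀ _ : Finset ι, _))

lemma isIrreducible_iff_isConnectedDiagram {L : Type*} [LieRing L] [LieAlgebra ℝ L] {n : ℕ}
    {b : Basis (Fin n) ℝ L} {l : List (Arrow (Fin n))} (hl : l.toFinset = arrows (lieCoeff b)) :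
    IsIrreducible b ↔ IsConnectedDiagram l := by
  classical
  have hb := (isLieTensor_lieCoeff b).toIsAlternatingTensor
  have closed_iff (s : Finset (Fin n)) :
      (∀ i j k, lieCoeff b i j k ≠ 0 → (i ∈ s ↔ k ∈ s)) ↔
        ∀ a ∈ l, (a.src₁ ∈ s ↔ a.tgt ∈ s) ∧ (a.src₂ ∈ s ↔ a.tgt ∈ s) := by
    simp only [← List.mem_toFinset (l := l), hl]
    refine ⟨fun h a ha => ?_, fun h i j k hijk => ?_⟩
    · have ne_zero := (mem_arrows.1 ha).2
      exact ⟨h _ _ _ ne_zero, h _ _ _ (hb.ne_zero_comm.2 ne_zero)⟩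
    · exact (hb.forall_of_arrows (Q := fun i j k => (i ∈ s ↔ k ∈ s) ∧ (j ∈ s ↔ k ∈ s))
        (fun _ _ _ => And.symm) h hijk).1
  rw [isIrreducible_iff, Fintype.finsetEquivSet.surjective.forall]
  simp only [IsConnectedDiagram, ← closed_iff, Fintype.finsetEquivSet_apply, Finset.mem_coe,
    Finset.coe_nonempty, Finset.coe_eq_univ]

end Connected

/-! ### The Lie algebra of a Lie tensor -/

section Existence

universe u v

variable {R : Type u} {ι : Type v} [CommRing R] [Fintype ι]

/-- The bilinear bracket with given structure constants. -/
noncomputable def structureBracket (c : ι → ι → ι → R) :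
    (ι →₀ R) →ₗ[R] (ι →₀ R) →ₗ[R] (ι →₀ R) :=
  Finsupp.basisSingleOne.constr R fun i => Finsupp.basisSingleOne.constr R fun j =>
    Finsupp.equivFunOnFinite.symm (c i j)

variable {c : ι → ι → ι → R}

lemma structureBracket_apply (x y : ι →₀ R) (k : ι) :
    structureBracket c x y k = ∑ i, ∑ j, x i * y j * c i j k := by
  simp [structureBracket, Basis.constr_apply_fintype, Finsupp.coe_finsetSum, Finset.mul_sum,
    mul_assoc]

lemma structureBracket_single_apply (i j k : ι) :
    structureBracket c (Finsupp.single i 1) (Finsupp.single j 1) k = c i j k := by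
  classical
  simp [structureBracket_apply, Finsupp.single_apply]

lemma IsAlternatingTensor.structureBracket_self (hc : IsAlternatingTensor c) (x : ι →₀ R) :
    structureBracket c x x = 0 := by
  classical
  ext k
  rw [structureBracket_apply, ← Fintype.sum_prod_type', Finsupp.zero_apply]
  refine Finset.sum_involution (fun p _ => p.swap) (fun p _ => ?_) (fun p _ hp heq => hp ?_)
    (fun p _ => Finset.mem_univ _) (fun p _ => p.swap_swap)
  · rw [Prod.fst_swap, Prod.snd_swap, hc.skew p.1 p.2]
    ring
  · rw [show p.2 = p.1 from congrArg Prod.fst heq, hc.self, mul_zero]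

lemma IsLieTensor.structureBracket_leibniz_single (hc : IsLieTensor c) (i j k : ι) :
    structureBracket c (.single i 1) (structureBracket c (.single j 1) (.single k 1)) =
      structureBracket c (structureBracket c (.single i 1) (.single j 1)) (.single k 1) +
        structureBracket c (.single j 1) (structureBracket c (.single i 1) (.single k 1)) := by
  classical
  ext u
  rw [Finsupp.add_apply, structureBracket_apply, structureBracket_apply (.single j 1),
    structureBracket_apply _ (.single k 1)]
  simp only [structureBracket_single_apply, Finsupp.single_apply, ite_mul, mul_ite, one_mul,
    mul_one, zero_mul, mul_zero, Finset.sum_ite_irrel, Finset.sum_const_zero, Finset.sum_ite_eq,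
    Finset.mem_univ, if_true]
  rw [← sub_eq_zero, ← neg_eq_zero, ← hc.jacobi i j k u, jacobiator, ← Finset.sum_add_distrib,
    ← Finset.sum_sub_distrib, ← Finset.sum_neg_distrib]
  refine Finset.sum_congr rfl fun w _ => ?_
  rw [hc.skew i w u, hc.skew i k w, hc.skew j w u]
  ring

lemma IsLieTensor.structureBracket_leibniz (hc : IsLieTensor c) (x y z : ι →₀ R) :
    structureBracket c x (structureBracket c y z) =
      structureBracket c (structureBracket c x y) z +
        structureBracket c y (structureBracket c x z) := by
  induction x using Finsupp.induction_linear with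
  | zero => simp
  | add x x' hx hx' => simp only [map_add, LinearMap.add_apply, hx, hx']; abel
  | single i s =>
    induction y using Finsupp.induction_linear with
    | zero => simp
    | add y y' hy hy' => simp only [map_add, LinearMap.add_apply, hy, hy']; abel
    | single j t =>
      induction z using Finsupp.induction_linear with
      | zero => simp
      | add z z' hz hz' => simp only [map_add, hz, hz']; abel
      | single k r =>
        rw [← Finsupp.smul_single_one i, ← Finsupp.smul_single_one j, ← Finsupp.smul_single_one k]
        simp only [map_smul, LinearMap.smul_apply, hc.structureBracket_leibniz_single i j k]
        module

theorem IsLieTensor.exists_lieAlgebra (hc : IsLieTensor c) :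
    ∃ (L : Type (max u v)) (_ : LieRing L) (_ : LieAlgebra R L) (b : Basis ι R L),
      ∀ i j k, lieCoeff b i j k = c i j k := by
  let lieRing : LieRing (ι →₀ R) :=
    { bracket := fun x y => structureBracket c x y
      add_lie := fun x y z => by simp only [map_add, LinearMap.add_apply]
      lie_add := fun x y z => map_add _ _ _
      lie_self := hc.structureBracket_self
      leibniz_lie := hc.structureBracket_leibniz }
  let lieAlgebra : LieAlgebra R (ι →₀ R) :=
    { lie_smul := fun t x y => map_smul _ _ _ }
  exact ⟨ι →₀ R, lieRing, lieAlgebra, Finsupp.basisSingleOne, fun i j k =>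
    structureBracket_single_apply i j k⟩

end Existence

/-! ### The rows of the table -/

namespace Row

/-- The arrows of the diagram of a row, in the order of the terms of the row. -/
def arrowList (r : Row) : List (Arrow (Fin r.n)) :=
  (List.finRange r.n).flatMap fun k => (r.d.get k).filterMap fun t =>
    if h : t.2.1 - 1 < r.n ∧ t.2.2 - 1 < r.n then some ⟨⟨_, h.1⟩, ⟨_, h.2⟩, k⟩ else none

/-- The diagonal of `N` divided by `r.scale`. -/
def weight (r : Row) (i : Fin r.n) : ℤ := r.weights.getD i 0

/-- The row `r'` differs from `r` only in the sign of the structure constant at the arrow `a₀`. -/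
def IsSignPartner (r r' : Row) (a₀ : Arrow (Fin r.n)) : Prop :=
  ∃ h : r.n = r'.n, ∀ i j k, i < j →
    r'.structConst (i.cast h) (j.cast h) (k.cast h) =
      if ⟨i, j, k⟩ = a₀ then -r.structConst i j k else r.structConst i j k

lemma nik_eq (r : Row) (i : Fin r.n) : r.nik i = ((r.scale * r.weight i : ℚ) : ℝ) := rfl

lemma isAlternatingTensor_structConst (r : Row) : IsAlternatingTensor r.structConst where
  self i k := by simp [structConst]
  skew i j k := by
    simp only [structConst]
    rw [neg_neg, List.sum_neg, List.map_map]
    refine congrArg List.sum (congrArg₂ List.map (funext fun t => ?_) rfl)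
    exact (neg_mul_eq_mul_neg _ _).trans (by rw [neg_sub])

lemma mem_arrowList_of_structConst_ne_zero : ∀ r ∈ table, ∀ i j k, i < j →
    r.structConst i j k ≠ 0 → ⟨i, j, k⟩ ∈ r.arrowList := by
  decide +kernel

lemma of_mem_arrowList : ∀ r ∈ table, ∀ a ∈ r.arrowList,
    a.src₁ < a.src₂ ∧ a.src₂ < a.tgt ∧ a.coeff r.structConst ^ 2 = 1 := by
  decide +kernel

lemma structConst_unique : ∀ r ∈ table, ∀ a ∈ r.arrowList,
    (∀ k, r.structConst a.src₁ a.src₂ k ≠ 0 → k = a.tgt) ∧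
      (∀ j, r.structConst a.src₁ j a.tgt ≠ 0 → j = a.src₂) ∧
      ∀ i, r.structConst i a.src₂ a.tgt ≠ 0 → i = a.src₁ := by
  decide +kernel

lemma jacobiator_structConst : ∀ r ∈ table, ∀ a ∈ r.arrowList, ∀ k u,
    r.structConst a.tgt k u ≠ 0 → jacobiator r.structConst a.src₁ a.src₂ k u = 0 := by
  unfold jacobiator
  decide +kernel

lemma pairing_weight : ∀ r ∈ table, ∀ a ∈ r.arrowList, a.pairing r.weight = 0 := by
  decide +kernel

lemma exists_scale_mul_weight_ne_zero : ∀ r ∈ table, ∃ i, r.scale * r.weight i ≠ 0 := by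
  decide +kernel

lemma isBalanced_iff : ∀ r ∈ table, ∀ s : Finset (Fin r.n),
    (∀ a ∈ r.arrowList, a.IsBalanced s) ↔ ∃ l ∈ r.sig, ∀ i : Fin r.n, i ∈ s ↔ (i : ℕ) + 1 ∈ l := by
  decide +kernel

lemma isConnectedDiagram_arrowList : ∀ r ∈ table, IsConnectedDiagram r.arrowList := by
  decide +kernel

section Table

variable {r : Row} (hr : r ∈ table)
include hr

lemma arrows_structConst : arrows r.structConst = r.arrowList.toFinset := by
  ext a
  rw [mem_arrows, List.mem_toFinset]
  refine ⟨fun ⟨h, hne⟩ => mem_arrowList_of_structConst_ne_zero r hr _ _ _ h hne, fun ha => ?_⟩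
  obtain ⟨h, -, hsq⟩ := of_mem_arrowList r hr a ha
  exact ⟨h, fun h0 => by simp [h0] at hsq⟩

lemma mem_arrows_structConst {a : Arrow (Fin r.n)} :
    a ∈ arrows r.structConst ↔ a ∈ r.arrowList := by
  rw [arrows_structConst hr, List.mem_toFinset]

lemma forall_of_arrowList {Q : Fin r.n → Fin r.n → Fin r.n → Prop}
    (hQ : ∀ i j k, Q i j k → Q j i k) (h : ∀ a ∈ r.arrowList, Q a.src₁ a.src₂ a.tgt)
    {i j k : Fin r.n} (hijk : r.structConst i j k ≠ 0) : Q i j k :=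
  r.isAlternatingTensor_structConst.forall_of_arrows hQ
    (fun a ha => h a ((mem_arrows_structConst hr).1 ha)) hijk

lemma isNiceTensor_structConst : IsNiceTensor r.structConst :=
  r.isAlternatingTensor_structConst.isNiceTensor_of_arrows fun a ha =>
    structConst_unique r hr a ((mem_arrows_structConst hr).1 ha)

lemma isLieTensor_structConst : IsLieTensor r.structConst :=
  r.isAlternatingTensor_structConst.isLieTensor_of_arrows fun a ha =>
    jacobiator_structConst r hr a ((mem_arrows_structConst hr).1 ha)

lemma isTriangular_structConst : IsTriangular r.structConst := fun _ _ _ h =>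
  forall_of_arrowList hr (Q := fun i j k => i < k ∧ j < k) (fun _ _ _ => And.symm)
    (fun a ha => let ⟨h, h', _⟩ := of_mem_arrowList r hr a ha; ⟨h.trans h', h'⟩) h

lemma structConst_sq {i j k : Fin r.n} (h : r.structConst i j k ≠ 0) :
    r.structConst i j k ^ 2 = 1 :=
  forall_of_arrowList hr (Q := fun i j k => r.structConst i j k ^ 2 = 1)
    (fun i j k hQ => by rwa [r.isAlternatingTensor_structConst.skew, neg_sq])
    (fun a ha => (of_mem_arrowList r hr a ha).2.2) h

lemma weight_add_weight {i j k : Fin r.n} (h : r.structConst i j k ≠ 0) :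
    r.weight i + r.weight j = r.weight k :=
  forall_of_arrowList hr (Q := fun i j k => r.weight i + r.weight j = r.weight k)
    (fun i j k hQ => by rwa [add_comm])
    (fun a ha => sub_eq_zero.1 (pairing_weight r hr a ha)) h

lemma nik_ne_zero : r.nik ≠ 0 := fun h => by
  obtain ⟨i, hi⟩ := exists_scale_mul_weight_ne_zero r hr
  exact hi (by simpa [nik_eq] using congrFun h i)

end Table

end Row

/-! ### Certificates for the rows of the table -/

/-- Data about a row of the table. `lam`: the values of `g_k / (g_i g_j)` for the normalized
nilsoliton metrics. `dual`: a dual system of the incidence vectors of the arrows. If these are not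
part of a basis of the lattice of integer vectors, this applies to all arrows but one; the entry
of that arrow is then a vector orthogonal to the other arrows, or empty if they span its incidence
vector. Both are ordered in the same way as the terms of the row. -/
structure Certificate where
  lam : List ℚ
  dual : List (List ℤ)

/-- The certificates for the rows of the table. -/
def certificates : List Certificate :=
  [
   ⟨[1/3],
    [[1, 0, 0]]⟩,
   ⟨[1/3, 1/3],
    [[0, 1, 0, 0], [0, 0, 0, -1]]⟩,
   ⟨[1/4, 1/3, 1/4],
    [[0, 1, 0, 0, 0], [0, 1, 1, 0, 0], [0, 0, 0, 0, -1]]⟩,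
   ⟨[3/11, 3/11, 2/11, 2/11],
    [[0, 0, -1, -1, -1], [0, -1, -1, -2, -2], [0, -1, -1, -1, -2], [0, 1, 1, 1, 1]]⟩,
   ⟨[1/3, 1/4, 1/4],
    [[1, 0, 0, 1, 0], [0, 0, 0, -1, 0], [0, 0, 0, 0, -1]]⟩,
   ⟨[2/7, 2/7, 1/7],
    [[1, 0, -1, 0, 0], [0, 0, -1, 0, -1], [0, 0, 1, 0, 0]]⟩,
   ⟨[1/4, 1/4],
    [[0, 1, 0, 0, 0], [0, 0, 1, 0, 0]]⟩,
   ⟨[1/4, 1/4],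
    [[1, 0, 0, 0, 0], [0, 0, 1, 0, 0]]⟩,
   ⟨[2/11, 3/11, 3/11, 2/11],
    [[0, 1, 0, 0, 0, 0], [0, 1, 1, 0, 0, 0], [0, 0, 0, 0, -1, -1], [0, 0, 0, 0, 0, -1]]⟩,
   ⟨[7/34, 15/68, 9/34, 2/17, 15/68],
    [[0, 0, -1, -1, -1, -1], [0, -1, -1, -2, -2, -2], [0, -1, -1, -1, -2, -2],
      [0, -1, -1, -1, -1, -2], [0, 1, 1, 1, 1, 1]]⟩,
   ⟨[1/4, 1/3, 1/4, 1/4, 1/4],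
    [[], [1, -1, 0, 0, 1, 0], [0, 1, 0, 0, -1, 0], [0, -1, 0, 0, 0, -1], [0, 1, 0, 0, 0, 0]]⟩,
   ⟨[2/13, 36/143, 30/143, 2/13, 25/143, 30/143],
    [[0, 0, -1, -1, -1, -1], [0, 0, 0, -1, -1, -1], [], [0, -1, -1, -1, -2, -2],
      [0, 1, 1, 1, 1, 1], [0, -1, -1, -1, -1, -2]]⟩,
   ⟨[1/4, 4/13, 1/13, 3/13, 3/13, 1/4],
    [[], [0, -1, -1, -2, -2, -3], [0, 1, 1, 1, 1, 2], [0, -1, -2, -2, -3, -4],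
      [0, 0, 1, 1, 1, 1], [0, 0, -1, -1, -1, -2]]⟩,
   ⟨[1/4, 1/4, 1/4, 1/4],
    [[0, 1, 0, 0, 1, 0], [0, 0, 0, -1, 0, -1], [0, 0, 0, 0, -1, 0], [0, 0, 0, 0, 0, -1]]⟩,
   ⟨[1/5, 1/4, 1/4, 1/5, 1/5],
    [[1, 0, 0, -1, 0, 0], [3, -1, 2, -3, 1, 0], [1, 0, 1, -1, 0, 0], [0, 0, 0, 1, 0, 0],
      [0, 0, 0, -1, 0, -1]]⟩,
   ⟨[1/5, 1/4, 1/4, 1/5, 1/5],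
    [[1, 0, 0, -1, 0, 0], [3, -1, 2, -3, 1, 0], [1, 0, 1, -1, 0, 0], [0, 0, 0, 1, 0, 0],
      [0, 0, 0, -1, 0, -1]]⟩,
   ⟨[1/5, 1/4, 1/4, 1/5, 1/5],
    [[1, 0, 0, 1, 0, 1], [], [0, 0, 0, -1, -1, -1], [0, 0, 0, 1, 0, 0], [0, 0, 0, -1, 0, -1]]⟩,
   ⟨[1/5, 1/3, 1/5, 1/5],
    [[0, 1, -1, 0, 0, 0], [0, 1, -1, 1, 0, 0], [0, 0, -1, 0, 0, -1], [0, 0, 1, 0, 0, 0]]⟩,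
   ⟨[1/4, 1/5, 1/5, 1/4, 1/5],
    [[0, 1, 0, 0, 0, 0], [0, 1, -1, 1, 0, 0], [], [0, 0, -1, 0, 0, -1], [0, 0, 1, 0, 0, 0]]⟩,
   ⟨[4/13, 3/13, 3/13, 1/13],
    [[1, 0, -1, 0, 1, 0], [0, 0, 0, 0, -1, 0], [0, 0, -1, 0, 0, -1], [0, 0, 1, 0, 0, 0]]⟩,
   ⟨[2/7, 1/14, 3/14, 1/14, 3/14],
    [[1, 0, -1, 0, -1, 0], [0, 0, 0, 0, -1, 0], [2, -1, -2, 1, -3, 0], [0, 0, 1, 0, 1, 0],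
      [0, 0, -1, 0, -1, -1]]⟩,
   ⟨[2/7, 1/14, 3/14, 3/14, 1/14],
    [[1, 0, -1, 0, -1, 0], [0, 0, 0, 0, -1, 0], [2, -1, -2, 1, -3, 0], [0, 0, -1, 0, -1, -1],
      [0, 0, 1, 0, 1, 0]]⟩,
   ⟨[2/7, 1/7, 2/7],
    [[0, 1, 0, 0, 0, 0], [0, 0, 1, 0, 0, 0], [0, 0, 0, 0, 0, -1]]⟩,
   ⟨[1/4, 1/4, 1/3],
    [[1, 0, -1, 0, 0, 0], [0, 0, 1, 0, 0, 0], [0, 0, 0, 0, 0, -1]]⟩,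
   ⟨[1/4, 1/8, 1/8, 1/4],
    [[0, 1, -1, 0, -1, 0], [0, 0, 0, 0, -1, 0], [0, 0, 1, 0, 1, 0], [0, 0, -1, 0, -1, -1]]⟩,
   ⟨[2/11, 3/11, 3/11, 2/11],
    [[1, 0, -2, 0, -1, 0], [0, 0, 1, 0, 0, 0], [0, 0, -1, 0, -1, -1], [0, 0, 1, 0, 1, 0]]⟩,
   ⟨[1/4, 1/4, 1/4, 1/4],
    [[0, 1, 0, -1, 0, 0], [1, 0, 0, 0, 0, 0], [-1, 0, 1, 0, 0, 0], [0, 1, 0, 0, 0, 0]]⟩,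
   ⟨[1/4, 1/4, 1/4, 1/4],
    [[0, 1, 0, -1, 0, 0], [1, 0, 0, 0, 0, 0], [0, 1, 0, 0, 0, 0], [-1, 0, 1, 0, 0, 0]]⟩,
   ⟨[1/4, 1/4, 1/4, 1/4],
    [[], [1, 0, 0, 0, 0, 0], [0, 0, 0, 1, 0, 0], [0, 1, 0, 0, 0, 0]]⟩,
   ⟨[1/5, 1/5, 1/5],
    [[0, 0, 0, -1, 0, 0], [0, 0, 0, 0, -1, 0], [0, 0, 0, 0, 0, -1]]⟩,
   ⟨[1/3, 1/4, 1/4],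
    [[0, 1, 0, 0, 0, 0], [1, -1, 0, 0, 0, 0], [0, 0, 1, 0, 0, 0]]⟩,
   ⟨[1/5, 1/5, 1/5],
    [[0, 0, 0, 0, -1, 0], [0, 0, 1, 0, 0, 0], [0, 0, 0, 1, 0, 0]]⟩,
   ⟨[1/6, 1/6, 1/6, 1/6],
    [[1, -1, 0, 0, -1, 0], [0, 0, 0, 0, -1, 0], [0, 0, 1, 0, 0, 0], [1, 0, 0, 0, 0, 0]]⟩,
   ⟨[1/6, 1/6, 1/6, 1/6],
    [[0, 0, 0, 0, -1, 0], [1, -1, 0, 0, -1, 0], [0, 0, 1, 0, 0, 0], [1, 0, 0, 0, 0, 0]]⟩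
  ]

namespace Certificate

variable (ct : Certificate) (r : Row)

/-- The value of `lam` at an arrow. -/
def lamAt (a : Arrow (Fin r.n)) : ℚ := ct.lam.getD (r.arrowList.idxOf a) 0

/-- The dual vector of an arrow. -/
def dualAt (a : Arrow (Fin r.n)) (h : Fin r.n) : ℤ :=
  (ct.dual.getD (r.arrowList.idxOf a) []).getD h 0

/-- The arrow `a₀` depends on the others only modulo 2, so that rescaling the basis leaves the sign
of its structure constant undetermined; the table contains rows for both signs. -/
def IsSignAmbiguous (a₀ : Arrow (Fin r.n)) : Prop :=
  (∀ a ∈ r.arrowList.toFinset.erase a₀, a.pairing (ct.dualAt r a₀) = 0) ∧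
    a₀.pairing (ct.dualAt r a₀) ≠ 0 ∧ ∃ r' ∈ table, r.IsSignPartner r' a₀

/-- The arrow `a₀` occurs in a Jacobi identity with two nonzero terms, and `lam` satisfies the
relation that this imposes. -/
def IsJacobiRelated (a₀ : Arrow (Fin r.n)) : Prop :=
  ∃ x y z w w' u, IsTwoTermJacobi r.structConst x y z w w' u ∧ Arrow.sorted ⟨x, y, w⟩ = a₀ ∧
    ct.lamAt r a₀ * ct.lamAt r (Arrow.sorted ⟨w, z, u⟩) =
      ct.lamAt r (Arrow.sorted ⟨y, z, w'⟩) * ct.lamAt r (Arrow.sorted ⟨w', x, u⟩)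

/-- The conditions on a certificate. -/
structure IsValid : Prop where
  lam_pos : ∀ a ∈ r.arrowList, 0 < ct.lamAt r a
  sum_root : ∀ h, ∑ a ∈ r.arrowList.toFinset, ct.lamAt r a * a.root ℚ h =
    1 - r.scale * r.weight h
  isDual : IsDual r.arrowList.toFinset (ct.dualAt r) 1 ∨
    ∃ a₀ ∈ r.arrowList, IsDual (r.arrowList.toFinset.erase a₀) (ct.dualAt r) 1 ∧
      (ct.IsSignAmbiguous r a₀ ∨ ct.IsJacobiRelated r a₀)

instance {ι : Type*} [DecidableEq ι] (S : Finset (Arrow ι)) (P : Arrow ι → ι → ℤ) (d : ℤ) :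
    Decidable (IsDual S P d) :=
  decidable_of_iff (d ≠ 0 ∧ ∀ a ∈ S, ∀ a' ∈ S, a'.pairing (P a) = if a = a' then d else 0)
    ⟨fun h => ⟨h.1, h.2⟩, fun h => ⟨h.1, h.2⟩⟩

instance (r' : Row) (a₀ : Arrow (Fin r.n)) : Decidable (r.IsSignPartner r' a₀) := by
  unfold Row.IsSignPartner
  infer_instance

instance (a₀ : Arrow (Fin r.n)) : Decidable (ct.IsSignAmbiguous r a₀) := by
  unfold IsSignAmbiguous
  infer_instance

/- The order of the quantifiers and conditions keeps the search short. -/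
instance (a₀ : Arrow (Fin r.n)) : Decidable (ct.IsJacobiRelated r a₀) :=
  decidable_of_iff
    (∃ x y w, Arrow.sorted ⟨x, y, w⟩ = a₀ ∧ r.structConst x y w ≠ 0 ∧
      ∃ z u, x ≠ z ∧ r.structConst w z u ≠ 0 ∧
        ∃ w', r.structConst y z w' ≠ 0 ∧ r.structConst w' x u ≠ 0 ∧
          (∀ p, r.structConst z x p ≠ 0 → r.structConst p y u = 0) ∧
          ct.lamAt r a₀ * ct.lamAt r (Arrow.sorted ⟨w, z, u⟩) =
            ct.lamAt r (Arrow.sorted ⟨y, z, w'⟩) * ct.lamAt r (Arrow.sorted ⟨w', x, u⟩))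
    ⟨fun ⟨x, y, w, ha₀, h₀, z, u, hxz, h₁, w', h₂, h₃, hp, hlam⟩ =>
      ⟨x, y, z, w, w', u, ⟨hxz, h₀, h₁, h₂, h₃, hp⟩, ha₀, hlam⟩,
    fun ⟨x, y, z, w, w', u, ⟨hxz, h₀, h₁, h₂, h₃, hp⟩, ha₀, hlam⟩ =>
      ⟨x, y, w, ha₀, h₀, z, u, hxz, h₁, w', h₂, h₃, hp, hlam⟩⟩

instance : Decidable (ct.IsValid r) :=
  decidable_of_iff
    ((∀ a ∈ r.arrowList, 0 < ct.lamAt r a) ∧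
      (∀ h, ∑ a ∈ r.arrowList.toFinset, ct.lamAt r a * a.root ℚ h =
        1 - r.scale * r.weight h) ∧
      (IsDual r.arrowList.toFinset (ct.dualAt r) 1 ∨
        ∃ a₀ ∈ r.arrowList, IsDual (r.arrowList.toFinset.erase a₀) (ct.dualAt r) 1 ∧
          (ct.IsSignAmbiguous r a₀ ∨ ct.IsJacobiRelated r a₀)))
    ⟨fun h => ⟨h.1, h.2.1, h.2.2⟩, fun h => ⟨h.1, h.2, h.3⟩⟩

lemma forall₂_isValid : List.Forall₂ IsValid certificates table := by
  decide +kernel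

lemma exists_isValid {r : Row} (hr : r ∈ table) : ∃ ct : Certificate, ct.IsValid r := by
  obtain ⟨i, hi, rfl⟩ := List.getElem_of_mem hr
  exact ⟨_, (List.forall₂_iff_get.1 Certificate.forall₂_isValid).2 i hi hi⟩

end Certificate

/-! ### Lie algebras with the structure equations of a row -/

lemma Certificate.IsValid.isRigid {ct : Certificate} {r : Row} (h : ct.IsValid r)
    (hr : r ∈ table) : IsRigid r.arrowList.toFinset fun a => (ct.lamAt r a : ℝ) := by
  have lam_pos : ∀ a ∈ r.arrowList.toFinset, (0 : ℝ) < ct.lamAt r a :=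
    fun a ha => Rat.cast_pos.2 (h.lam_pos a (List.mem_toFinset.1 ha))
  rcases h.isDual with hP | ⟨a₀, ha₀, hP, ⟨hp, hp₀, -⟩ | ⟨x, y, z, w, w', u, hJ, rfl, hlam⟩⟩
  · exact hP.isRigid lam_pos
  · obtain ⟨P', hP'⟩ := hP.exists_insert (Finset.notMem_erase _ _) hp hp₀
    rw [Finset.insert_erase (List.mem_toFinset.2 ha₀)] at hP'
    exact hP'.isRigid lam_pos
  · have parallelogram := r.isAlternatingTensor_structConst.isParallelogram
      (Row.isTriangular_structConst hr) hJ
    rw [Row.arrows_structConst hr] at parallelogram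
    rw [← Finset.insert_erase (List.mem_toFinset.2 ha₀)] at lam_pos ⊢
    exact parallelogram.isRigid hP lam_pos (mod_cast hlam)

lemma hasStructure_iff {L : Type*} [LieRing L] [LieAlgebra ℝ L] {r : Row}
    (b : Basis (Fin r.n) ℝ L) :
    HasStructure r b ↔ ∀ i j k, lieCoeff b i j k = r.structConst i j k := by
  refine ⟨fun h i j k => ?_, fun h i j => ?_⟩
  · rw [lieCoeff, h i j]
    simp [Finsupp.single_apply]
  · simp only [lie_basis, h]

theorem Row.exists_hasStructure {r : Row} (hr : r ∈ table) :
    ∃ (L : Type) (_ : LieRing L) (_ : LieAlgebra ℝ L) (b : Basis (Fin r.n) ℝ L),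
      HasStructure r b := by
  obtain ⟨L, _, _, b, hb⟩ :=
    ((isLieTensor_structConst hr).map (Int.castRingHom ℝ)).exists_lieAlgebra
  exact ⟨L, _, _, b, (hasStructure_iff b).2 hb⟩

namespace HasStructure

variable {L : Type*} [LieRing L] [LieAlgebra ℝ L] {r : Row} {b : Basis (Fin r.n) ℝ L}
  (hb : HasStructure r b)
include hb

lemma lieCoeff_eq (i j k : Fin r.n) : lieCoeff b i j k = r.structConst i j k :=
  (hasStructure_iff b).1 hb i j k

lemma lieCoeff_ne_zero_iff (i j k : Fin r.n) :
    lieCoeff b i j k ≠ 0 ↔ r.structConst i j k ≠ 0 := by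
  rw [hb.lieCoeff_eq, Int.cast_ne_zero]

variable (hr : r ∈ table)
include hr

lemma arrows_lieCoeff : arrows (lieCoeff b) = r.arrowList.toFinset := by
  ext a
  rw [← Row.arrows_structConst hr, mem_arrows, mem_arrows, Arrow.coeff,
    hb.lieCoeff_ne_zero_iff, Arrow.coeff]

theorem isNiceTensor : IsNiceTensor (lieCoeff b) :=
  (Row.isNiceTensor_structConst hr).of_ne_zero fun i j k => (hb.lieCoeff_ne_zero_iff i j k).1

theorem isTriangular : IsTriangular (lieCoeff b) :=
  (Row.isTriangular_structConst hr).of_ne_zero fun i j k => (hb.lieCoeff_ne_zero_iff i j k).1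

theorem isIrreducible : IsIrreducible b :=
  (isIrreducible_iff_isConnectedDiagram (hb.arrows_lieCoeff hr).symm).2
    (Row.isConnectedDiagram_arrowList r hr)

lemma sum_lamAt_mul_root {ct : Certificate} (hct : ct.IsValid r) (h : Fin r.n) :
    ∑ a ∈ arrows (lieCoeff b), (ct.lamAt r a : ℝ) * a.root ℝ h = 1 - r.nik h := by
  have root_cast (a : Arrow (Fin r.n)) : a.root ℝ h = (a.root ℚ h : ℝ) := by
    simp only [Arrow.root, Arrow.pairing, Pi.single_apply]
    push_cast [apply_ite ((↑) : ℚ → ℝ)]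
    rfl
  rw [hb.arrows_lieCoeff hr, Row.nik_eq]
  simp only [root_cast]
  exact_mod_cast congrArg (Rat.cast : ℚ → ℝ) (hct.sum_root h)

theorem isDiagonalNikolayevsky : IsDiagonalNikolayevsky b r.nik := by
  obtain ⟨ct, hct⟩ := Certificate.exists_isValid hr
  refine isDiagonalNikolayevsky_of_sum_root (hb.isNiceTensor hr) (fun i j k hijk => ?_) _
    (hb.sum_lamAt_mul_root hr hct)
  rw [Row.nik_eq, Row.nik_eq, Row.nik_eq,
    ← Row.weight_add_weight hr ((hb.lieCoeff_ne_zero_iff i j k).1 hijk)]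
  push_cast
  ring

theorem signatures_eq : signatures b = r.sigSet := by
  obtain ⟨ct, hct⟩ := Certificate.exists_isValid hr
  have rigid := hct.isRigid hr
  rw [← hb.arrows_lieCoeff hr] at rigid
  have sq (i j k : Fin r.n) (h : lieCoeff b i j k ≠ 0) : lieCoeff b i j k ^ 2 = 1 := by
    rw [hb.lieCoeff_eq]
    exact_mod_cast Row.structConst_sq hr ((hb.lieCoeff_ne_zero_iff i j k).1 h)
  rw [signatures_eq_of_isRigid (hb.isNiceTensor hr) (hb.isTriangular hr) sq (Row.nik_ne_zero hr)
    (hb.isDiagonalNikolayevsky hr) (hb.sum_lamAt_mul_root hr hct) rigid]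
  ext s
  simp only [hb.arrows_lieCoeff hr, List.mem_toFinset, Set.mem_ofPred_eq, Row.sigSet]
  exact Row.isBalanced_iff r hr s

end HasStructure

/-! ### Normalization of the structure constants -/

section Normalization

lemma IsAlternatingTensor.coeff_sorted_div {K ι : Type*} [Field K] [LinearOrder ι]
    {c d : ι → ι → ι → K} (hc : IsAlternatingTensor c) (hd : IsAlternatingTensor d)
    (a : Arrow ι) : a.sorted.coeff c / a.sorted.coeff d = a.coeff c / a.coeff d := by
  rcases a.sorted_eq_or with h | h
  · rw [h]
  · simp only [h, Arrow.coeff]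
    rw [hc.skew, hd.skew, neg_div_neg_eq]

lemma IsTwoTermJacobi.div_mul_div_eq {K ι : Type*} [Field K] [Fintype ι] {c d : ι → ι → ι → K}
    {x y z w w' u : ι} (hc : IsLieTensor c) (hc' : IsNiceTensor c)
    (h : IsTwoTermJacobi c x y z w w' u) (hd : IsLieTensor d) (hd' : IsNiceTensor d)
    (h' : IsTwoTermJacobi d x y z w w' u) :
    c x y w / d x y w * (c w z u / d w z u) = c y z w' / d y z w' * (c w' x u / d w' x u) := by
  have jacobi_c := hc.mul_add_mul_eq_zero hc' h
  have jacobi_d := hd.mul_add_mul_eq_zero hd' h'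
  obtain ⟨-, h₀, h₁, h₂, h₃, -⟩ := h'
  field_simp
  linear_combination d y z w' * d w' x u * jacobi_c - c y z w' * c w' x u * jacobi_d

lemma IsTwoTermJacobi.exists_ratio_eq_div {K ι : Type*} [Field K] [DecidableEq K] [Fintype ι]
    [LinearOrder ι] {c d : ι → ι → ι → K} {x y z w w' u : ι} {P : Arrow ι → ι → ℤ}
    (hc : IsLieTensor c) (hc' : IsNiceTensor c) (hct : IsTriangular c) (hd : IsLieTensor d)
    (hcd : ∀ i j k, c i j k ≠ 0 ↔ d i j k ≠ 0)
    (h : IsTwoTermJacobi c x y z w w' u)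
    (hP : IsDual ((arrows c).erase (Arrow.sorted ⟨x, y, w⟩)) P 1) :
    ∃ t : ι → K, (∀ i, t i ≠ 0) ∧ ∀ a ∈ arrows c, a.ratio t = a.coeff c / a.coeff d := by
  have div_ne_zero {a : Arrow ι} (ha : a ∈ arrows c) : a.coeff c / a.coeff d ≠ 0 :=
    have ne_zero := (mem_arrows.1 ha).2
    div_ne_zero ne_zero ((hcd _ _ _).1 ne_zero)
  obtain ⟨t, ht, ratio_eq⟩ := hP.exists_ne_zero (y := fun a => a.coeff c / a.coeff d)
    fun a ha => div_ne_zero (Finset.mem_of_mem_erase ha)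
  refine ⟨t, ht, fun a ha => ?_⟩
  by_cases ha₀ : a = Arrow.sorted ⟨x, y, w⟩
  · rw [ha₀]
    refine (hc.isParallelogram hct h).ratio_eq ht ratio_eq
      (div_ne_zero (hc.sorted_mem_arrows.2 h.ne_zero₁)) ?_
    simp only [hc.coeff_sorted_div hd.toIsAlternatingTensor]
    exact h.div_mul_div_eq hc hc' hd (hc'.of_ne_zero fun i j k => (hcd i j k).2)
      (h.of_ne_zero_iff hcd)
  · exact ratio_eq a (Finset.mem_erase.2 ⟨ha₀, ha⟩)

variable {r : Row} {ct : Certificate}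

lemma Certificate.IsValid.exists_ratio_eq_div (hct : ct.IsValid r) (hr : r ∈ table)
    {c : Fin r.n → Fin r.n → Fin r.n → ℝ} (hc : IsLieTensor c)
    (hcr : ∀ i j k, c i j k ≠ 0 ↔ r.structConst i j k ≠ 0) :
    ∃ t : Fin r.n → ℝ, (∀ i, t i ≠ 0) ∧
      ((∀ a ∈ arrows c, a.ratio t = a.coeff c / a.coeff r.structConst) ∨
        ∃ a₀, (∃ r' ∈ table, r.IsSignPartner r' a₀) ∧
          (∀ a ∈ (arrows c).erase a₀, a.ratio t = a.coeff c / a.coeff r.structConst) ∧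
          a₀.ratio t = -(a₀.coeff c / a₀.coeff r.structConst)) := by
  have arrows_eq : r.arrowList.toFinset = arrows c := by
    ext a
    rw [← Row.arrows_structConst hr, mem_arrows, mem_arrows, Arrow.coeff, Arrow.coeff, hcr]
  have quotient_ne_zero (a) (ha : a ∈ arrows c) : a.coeff c / a.coeff r.structConst ≠ 0 :=
    have ne_zero := (mem_arrows.1 ha).2
    div_ne_zero ne_zero (Int.cast_ne_zero.2 ((hcr _ _ _).1 ne_zero))
  have hd := (Row.isLieTensor_structConst hr).map (Int.castRingHom ℝ)
  have hcd (i j k : Fin r.n) : c i j k ≠ 0 ↔ Int.castRingHom ℝ (r.structConst i j k) ≠ 0 := by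
    rw [hcr, eq_intCast, Int.cast_ne_zero]
  rcases hct.isDual with hP | ⟨a₀, ha₀, hP, ⟨hp, hp₀, partner⟩ | ⟨x, y, z, w, w', u, hJ, rfl, -⟩⟩
  · obtain ⟨t, ht, ratio_eq⟩ := (arrows_eq ▸ hP).exists_ne_zero quotient_ne_zero
    exact ⟨t, ht, Or.inl ratio_eq⟩
  · obtain ⟨P', hP'⟩ := hP.exists_insert (Finset.notMem_erase _ _) hp hp₀
    rw [← List.mem_toFinset, arrows_eq] at ha₀
    rw [arrows_eq] at hP hP'
    obtain ⟨t, ht, ratio_eq, ratio_eq₀ | ratio_eq₀⟩ := hP.exists_up_to_sign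
      (Finset.notMem_erase _ _) hP' (by rwa [Finset.insert_erase ha₀])
    · refine ⟨t, ht, Or.inl fun a ha => ?_⟩
      rw [← Finset.insert_erase ha₀] at ha
      rcases Finset.mem_insert.1 ha with rfl | ha
      exacts [ratio_eq₀, ratio_eq a ha]
    · exact ⟨t, ht, Or.inr ⟨a₀, partner, ratio_eq, ratio_eq₀⟩⟩
  · have hJ' := hJ.of_ne_zero_iff fun i j k => (hcr i j k).symm
    obtain ⟨t, ht, ratio_eq⟩ := hJ'.exists_ratio_eq_div hc
      ((Row.isNiceTensor_structConst hr).of_ne_zero fun i j k => (hcr i j k).1)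
      ((Row.isTriangular_structConst hr).of_ne_zero fun i j k => (hcr i j k).1) hd hcd
      (arrows_eq ▸ hP)
    exact ⟨t, ht, Or.inl ratio_eq⟩

variable {L : Type*} [LieRing L] [LieAlgebra ℝ L]

lemma isEquivalentTo_of_coeff_eq_mul_ratio {n : ℕ} {b : Basis (Fin n) ℝ L} (e : Fin r.n ≃ Fin n)
    {t : Fin n → ℝ} (ht : ∀ i, t i ≠ 0)
    (h : ∀ i j k, i < j → lieCoeff b (e i) (e j) (e k) =
      r.structConst i j k * Arrow.ratio ⟨e i, e j, e k⟩ t) : IsEquivalentTo b r e := by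
  have coeff_eq (i j k : Fin r.n) : lieCoeff b (e i) (e j) (e k) =
      r.structConst i j k * Arrow.ratio ⟨e i, e j, e k⟩ t := by
    rcases lt_trichotomy i j with hij | rfl | hji
    · exact h i j k hij
    · simp [lieCoeff_self, r.isAlternatingTensor_structConst.self]
    · rw [lieCoeff_skew, h j i k hji, r.isAlternatingTensor_structConst.skew i j k, Int.cast_neg,
        neg_mul, neg_mul_eq_neg_mul, Arrow.ratio, Arrow.ratio, mul_comm (t (e j))]
      ring
  refine ⟨fun i => Units.mk0 (t (e i)) (ht _), (hasStructure_iff _).2 fun i j k => ?_⟩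
  rw [(IsRescaling.unitsSMul_reindex b e _).lieCoeff_eq, coeff_eq]
  exact mul_div_cancel_right₀ _ (Arrow.ratio_ne_zero ⟨e i, e j, e k⟩ ht)

theorem exists_isEquivalentTo_of_lieCoeff_ne_zero_iff (hr : r ∈ table)
    {b : Basis (Fin r.n) ℝ L}
    (hb : ∀ i j k, lieCoeff b i j k ≠ 0 ↔ r.structConst i j k ≠ 0) :
    ∃ r' ∈ table, ∃ e : Fin r'.n ≃ Fin r.n, IsEquivalentTo b r' e := by
  obtain ⟨ct, hct⟩ := Certificate.exists_isValid hr
  obtain ⟨t, ht, h⟩ := hct.exists_ratio_eq_div hr (isLieTensor_lieCoeff b) hb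
  have eq_mul_ratio {i j k : Fin r.n} {s : ℤ} (hij : i < j)
      (hs : s ≠ 0 → r.structConst i j k ≠ 0) (hs' : s = 0 → r.structConst i j k = 0)
      (ratio_eq : ⟨i, j, k⟩ ∈ arrows (lieCoeff b) →
        Arrow.ratio ⟨i, j, k⟩ t = lieCoeff b i j k / s) :
      lieCoeff b i j k = s * Arrow.ratio ⟨i, j, k⟩ t := by
    by_cases hne : s = 0
    · rw [not_ne_iff.1 fun h => (hb _ _ _).1 h (hs' hne), hne, Int.cast_zero, zero_mul]
    · rw [ratio_eq (mem_arrows.2 ⟨hij, (hb _ _ _).2 (hs hne)⟩),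
        mul_div_cancel₀ _ (Int.cast_ne_zero.2 hne)]
  rcases h with ratio_eq | ⟨a₀, ⟨r', hr', hn, partner⟩, ratio_eq, ratio_eq₀⟩
  · exact ⟨r, hr, .refl _, isEquivalentTo_of_coeff_eq_mul_ratio _ ht fun i j k hij =>
      eq_mul_ratio hij id id (ratio_eq _)⟩
  · refine ⟨r', hr', finCongr hn.symm, isEquivalentTo_of_coeff_eq_mul_ratio _ ht
      fun i j k hij => ?_⟩
    rw [show r'.structConst i j k = _ from
      partner (i.cast hn.symm) (j.cast hn.symm) (k.cast hn.symm) hij]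
    split_ifs with ha
    · subst ha
      refine eq_mul_ratio hij neg_ne_zero.1 neg_eq_zero.1 fun _ => ?_
      rw [Int.cast_neg, div_neg]
      exact ratio_eq₀
    · exact eq_mul_ratio hij id id fun ha' => ratio_eq _ (Finset.mem_erase.2 ⟨ha, ha'⟩)

end Normalization

/-! ### Enumeration of the diagrams -/

section Diagrams

variable {n : ℕ}

/-- The arrow obtained by relabelling the nodes. -/
def Arrow.map {ι κ : Type*} (σ : ι → κ) (a : Arrow ι) : Arrow κ :=
  ⟨σ a.src₁, σ a.src₂, σ a.tgt⟩

/-- No node is a source of both arrows. -/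
def Arrow.DisjointSources {ι : Type*} (a a' : Arrow ι) : Prop :=
  (a.src₁ ≠ a'.src₁ ∧ a.src₁ ≠ a'.src₂) ∧ a.src₂ ≠ a'.src₁ ∧ a.src₂ ≠ a'.src₂

instance {ι : Type*} [DecidableEq ι] (a a' : Arrow ι) : Decidable (a.DisjointSources a') :=
  inferInstanceAs (Decidable (_ ∧ _))

/-- The possible diagrams of nice bases whose structure constants are triangular, with arrows
starting from the given pairs of nodes only. -/
def diagrams (n : ℕ) : List (Fin n × Fin n) → List (List (Arrow (Fin n)))
  | [] => [[]]
  | p :: ps => (diagrams n ps).flatMap fun l =>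
      l :: (((List.finRange n).map (Arrow.mk p.1 p.2)).filter fun a =>
        a.src₂ < a.tgt ∧ ∀ a' ∈ l, a'.tgt = a.tgt → a'.DisjointSources a).map (· :: l)

/-- The pairs `(i, j)` with `i < j`. -/
def sourcePairs (n : ℕ) : List (Fin n × Fin n) :=
  ((List.finRange n).product (List.finRange n)).filter fun p => p.1 < p.2

/-- Structure constants supported on the diagram `l` violate the Jacobi identity, because one of
its components has exactly one nonzero term. -/
def HasJacobiObstruction (l : List (Arrow (Fin n))) : Prop :=
  ∃ a ∈ l, ∃ a' ∈ l, ∃ z, Arrow.sorted ⟨a.tgt, z, a'.tgt⟩ = a' ∧ ∀ w,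
    (Arrow.sorted ⟨a.src₂, z, w⟩ ∈ l → Arrow.sorted ⟨w, a.src₁, a'.tgt⟩ ∉ l) ∧
      (Arrow.sorted ⟨z, a.src₁, w⟩ ∈ l → Arrow.sorted ⟨w, a.src₂, a'.tgt⟩ ∉ l)

/-- An isomorphism invariant computed from the numbers of arrows into and out of the nodes.
Comparing it first only serves to keep the search for isomorphisms short. -/
def degreeCode (l : List (Arrow (Fin n))) : ℕ :=
  ((List.finRange n).map fun i => 10 ^ (l.map fun a =>
    if a.tgt = i then 5 else if a.src₁ = i ∨ a.src₂ = i then 1 else 0).sum).sum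

/-- The map `σ` is an isomorphism from `l` to the diagram of the row `r`. -/
def IsDiagramIso (l : List (Arrow (Fin n))) (r : Row) (σ : Fin n → ℕ) : Prop :=
  List.Perm (l.map fun a => (a.map σ).sorted) (r.arrowList.map fun a => (a.map Fin.val).sorted) ∧
    (∀ i, σ i < r.n) ∧ Function.Injective σ

/-- Permutations that suffice to bring every diagram into the form used in the table. -/
def renamings : List (List ℕ) :=
  [[1, 0, 2, 3, 4, 5], [0, 1, 2, 3, 4, 5], [2, 1, 0, 3, 4, 5], [2, 0, 1, 3, 4, 5],
   [1, 2, 0, 3, 4, 5], [0, 2, 1, 3, 4, 5], [1, 0, 3, 2, 4, 5], [0, 1, 3, 2, 4, 5],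
   [1, 0, 2, 4, 3, 5], [0, 1, 2, 4, 3, 5], [2, 1, 0, 4, 3, 5], [2, 0, 1, 4, 3, 5],
   [1, 2, 0, 4, 3, 5], [0, 2, 1, 4, 3, 5], [0, 1, 2, 3, 5, 4], [1, 0, 2, 3, 5, 4],
   [1, 2, 0, 3, 5, 4], [2, 1, 0, 3, 5, 4], [2, 0, 1, 3, 5, 4], [0, 2, 1, 3, 5, 4],
   [2, 0, 4, 1, 3, 5], [1, 0, 3, 2, 5, 4], [0, 2, 4, 1, 3, 5], [0, 1, 3, 2, 5, 4],
   [1, 2, 3, 0, 4, 5], [0, 2, 3, 1, 4, 5], [2, 3, 1, 0, 4, 5], [2, 1, 3, 0, 4, 5],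
   [2, 0, 3, 1, 4, 5], [2, 3, 0, 1, 4, 5], [1, 0, 3, 5, 2, 4], [1, 0, 4, 2, 3, 5],
   [0, 1, 3, 5, 2, 4], [1, 0, 3, 4, 2, 5], [0, 1, 4, 2, 3, 5], [0, 1, 3, 4, 2, 5],
   [2, 3, 1, 0, 5, 4], [2, 1, 3, 0, 5, 4], [2, 3, 0, 1, 5, 4], [0, 3, 2, 1, 5, 4],
   [2, 0, 3, 1, 5, 4], [0, 2, 3, 1, 5, 4]]

instance (l : List (Arrow (Fin n))) : Decidable (HasJacobiObstruction l) := by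
  unfold HasJacobiObstruction
  infer_instance

instance (l : List (Arrow (Fin n))) (r : Row) (σ : Fin n → ℕ) : Decidable (IsDiagramIso l r σ) :=
  inferInstanceAs (Decidable (_ ∧ _))

theorem diagrams_classified : ∀ n ∈ [2, 3, 4, 5, 6], ∀ l ∈ diagrams n (sourcePairs n),
    ¬IsConnectedDiagram l ∨ HasJacobiObstruction l ∨
      ∃ r ∈ table, r.n = n ∧ degreeCode l = degreeCode r.arrowList ∧
        ∃ p ∈ renamings, IsDiagramIso l r fun i => p.getD i 0 := by
  decide +kernel

end Diagrams

section Classification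

variable {R : Type*} {n : ℕ}

lemma IsNiceTensor.disjointSources {ι : Type*} [AddGroup R] [DecidableEq R] [Fintype ι]
    [LinearOrder ι] {c : ι → ι → ι → R} (hc : IsNiceTensor c) (hc' : IsAlternatingTensor c)
    {a a' : Arrow ι} (ha : a ∈ arrows c) (ha' : a' ∈ arrows c) (htgt : a'.tgt = a.tgt)
    (hne : a' ≠ a) : a'.DisjointSources a := by
  obtain ⟨i, j, k⟩ := a
  obtain ⟨i', j', k'⟩ := a'
  obtain rfl : k' = k := htgt
  obtain ⟨hij, h⟩ := mem_arrows.1 ha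
  obtain ⟨hij', h'⟩ := mem_arrows.1 ha'
  simp only [Arrow.coeff] at hij h hij' h'
  refine ⟨⟨?_, ?_⟩, ?_, ?_⟩ <;> rintro (rfl : _ = _)
  · exact hne (by rw [hc.src_unique h h'])
  · exact (hij'.trans_eq (hc.src_unique h' (hc'.ne_zero_comm.2 h))).asymm hij
  · exact (hij.trans_eq (hc.src_unique h (hc'.ne_zero_comm.2 h'))).asymm hij'
  · exact hne (by rw [hc.src_unique (hc'.ne_zero_comm.2 h) (hc'.ne_zero_comm.2 h')])

lemma mem_sourcePairs {p : Fin n × Fin n} : p ∈ sourcePairs n ↔ p.1 < p.2 := by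
  simp [sourcePairs, List.product, List.mem_flatMap]

lemma nodup_sourcePairs : (sourcePairs n).Nodup :=
  ((List.nodup_finRange n).product (List.nodup_finRange n)).filter _

lemma exists_mem_diagrams [AddGroup R] [DecidableEq R] {c : Fin n → Fin n → Fin n → R}
    (hc : IsAlternatingTensor c) (hc' : IsNiceTensor c) (hc'' : IsTriangular c)
    {ps : List (Fin n × Fin n)} (hps : ps.Nodup) (hlt : ∀ p ∈ ps, p.1 < p.2) :
    ∃ l ∈ diagrams n ps, ∀ a, a ∈ l ↔ (a.src₁, a.src₂) ∈ ps ∧ a ∈ arrows c := by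
  induction ps with
  | nil => exact ⟨[], by simp [diagrams]⟩
  | cons p ps ih =>
    rw [List.nodup_cons] at hps
    rw [List.forall_mem_cons] at hlt
    obtain ⟨l, hl, mem_l⟩ := ih hps.2 hlt.2
    by_cases hp : ∃ k, c p.1 p.2 k ≠ 0
    · obtain ⟨k, hk⟩ := hp
      have mem_arrows_k : ⟨p.1, p.2, k⟩ ∈ arrows c := mem_arrows.2 ⟨hlt.1, hk⟩
      refine ⟨⟨p.1, p.2, k⟩ :: l, ?_, fun a => ?_⟩
      · refine List.mem_flatMap.2 ⟨l, hl, List.mem_cons_of_mem _ (List.mem_map_of_mem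
          (List.mem_filter.2 ⟨List.mem_map_of_mem (List.mem_finRange k),
            decide_eq_true ⟨(hc'' hk).2, fun a ha htgt => ?_⟩⟩))⟩
        refine hc'.disjointSources hc mem_arrows_k ((mem_l a).1 ha).2 htgt ?_
        rintro rfl
        exact hps.1 ((mem_l _).1 ha).1
      · rw [List.mem_cons, mem_l, List.mem_cons, or_and_right]
        refine or_congr_left ⟨?_, fun ⟨h, ha⟩ => ?_⟩
        · rintro rfl
          exact ⟨rfl, mem_arrows_k⟩
        · obtain rfl := h
          rw [hc'.tgt_unique hk (mem_arrows.1 ha).2]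
    · push Not at hp
      refine ⟨l, List.mem_flatMap.2 ⟨l, hl, List.mem_cons_self⟩, fun a => ?_⟩
      rw [mem_l, List.mem_cons, or_and_right, or_iff_right]
      rintro ⟨rfl, ha⟩
      exact (mem_arrows.1 ha).2 (hp _)

lemma exists_mem_diagrams_toFinset_eq [AddGroup R] [DecidableEq R]
    {c : Fin n → Fin n → Fin n → R} (hc : IsAlternatingTensor c) (hc' : IsNiceTensor c)
    (hc'' : IsTriangular c) : ∃ l ∈ diagrams n (sourcePairs n), l.toFinset = arrows c := by
  obtain ⟨l, hl, mem_l⟩ :=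
    exists_mem_diagrams hc hc' hc'' nodup_sourcePairs fun _ => mem_sourcePairs.1
  refine ⟨l, hl, Finset.ext fun a => ?_⟩
  rw [List.mem_toFinset, mem_l, mem_sourcePairs, and_iff_right_of_imp fun h => (mem_arrows.1 h).1]

lemma not_hasJacobiObstruction [CommRing R] [IsDomain R] [DecidableEq R]
    {c : Fin n → Fin n → Fin n → R} {l : List (Arrow (Fin n))} (hc : IsLieTensor c)
    (hc' : IsNiceTensor c) (hl : l.toFinset = arrows c) : ¬HasJacobiObstruction l := by
  rintro ⟨a, ha, a', ha', z, hz, h⟩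
  have alt := hc.toIsAlternatingTensor
  have mem_l {i j k : Fin n} : Arrow.sorted ⟨i, j, k⟩ ∈ l ↔ c i j k ≠ 0 := by
    rw [← List.mem_toFinset, hl, alt.sorted_mem_arrows]
  rw [← hz, mem_l] at ha'
  rw [← List.mem_toFinset, hl, mem_arrows] at ha
  simp only [mem_l, not_not] at h
  refine mul_ne_zero ha.2 ha' (hc.mul_eq_zero_of_jacobi hc' ha.2 (fun w => ?_) fun w => ?_)
  · exact mul_eq_zero.2 (or_iff_not_imp_left.2 (h w).1)
  · exact mul_eq_zero.2 (or_iff_not_imp_left.2 (h w).2)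

lemma Arrow.sorted_map_eq_sorted_map {ι κ : Type*} [LinearOrder ι] [LinearOrder κ] {σ : ι → κ}
    (hσ : Function.Injective σ) {a a' : Arrow ι} :
    (a.map σ).sorted = (a'.map σ).sorted ↔ a.sorted = a'.sorted := by
  simp only [Arrow.sorted_eq_sorted, Arrow.map, hσ.eq_iff]

lemma Arrow.sorted_map_mem_map_iff {ι κ : Type*} [LinearOrder ι] [LinearOrder κ] {σ : ι → κ}
    (hσ : Function.Injective σ) {l : List (Arrow ι)} (hl : ∀ a ∈ l, a.src₁ < a.src₂)
    {a : Arrow ι} : (a.map σ).sorted ∈ l.map (fun a => (a.map σ).sorted) ↔ a.sorted ∈ l := by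
  have sorted_eq {a' : Arrow ι} (ha' : a' ∈ l) : a'.sorted = a' := if_pos (hl a' ha').le
  rw [List.mem_map]
  refine ⟨fun ⟨a', ha', h⟩ => ?_, fun h => ⟨_, h, ?_⟩⟩
  · rwa [← (sorted_map_eq_sorted_map hσ).1 h, sorted_eq ha']
  · rw [sorted_map_eq_sorted_map hσ, sorted_eq h]

lemma IsDiagramIso.exists_equiv {l : List (Arrow (Fin n))} {r : Row} {σ : Fin n → ℕ}
    (h : IsDiagramIso l r σ) (hn : r.n = n) (hl : ∀ a ∈ l, a.src₁ < a.src₂)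
    (hr : ∀ a ∈ r.arrowList, a.src₁ < a.src₂) :
    ∃ e : Fin r.n ≃ Fin n, ∀ i j k,
      Arrow.sorted ⟨e i, e j, e k⟩ ∈ l ↔ Arrow.sorted ⟨i, j, k⟩ ∈ r.arrowList := by
  obtain ⟨perm, lt, inj⟩ := h
  let τ (i : Fin n) : Fin r.n := ⟨σ i, lt i⟩
  have τ_inj : Function.Injective τ := fun i j hij => inj (congrArg Fin.val hij)
  let e := Equiv.ofBijective τ ((Fintype.bijective_iff_injective_and_card τ).2
    ⟨τ_inj, by rw [Fintype.card_fin, Fintype.card_fin, hn]⟩)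
  refine ⟨e.symm, fun i j k => ?_⟩
  rw [← Arrow.sorted_map_mem_map_iff inj hl, perm.mem_iff,
    ← Arrow.sorted_map_mem_map_iff Fin.val_injective hr]
  have σ_symm (i : Fin r.n) : σ (e.symm i) = i := congrArg Fin.val (e.apply_symm_apply i)
  simp only [Arrow.map, σ_symm]

lemma exists_isTriangular_reindex {L : Type*} [LieRing L] [LieAlgebra ℝ L]
    [LieRing.IsNilpotent L] {b : Basis (Fin n) ℝ L} (hb : IsNice b) :
    ∃ e : Fin n ≃ Fin n, IsTriangular (lieCoeff (b.reindex e)) := by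
  let depth := lowerCentralDepth ℝ ∘ b
  let e := Tuple.sort depth
  refine ⟨e.symm, fun i j k h => ?_⟩
  have lt := hb.lowerCentralDepth_lt
    (((IsRescaling.reindex b e).lieCoeff_ne_zero_iff i j k).1 h)
  exact ⟨(Tuple.monotone_sort depth).reflect_lt lt.1, (Tuple.monotone_sort depth).reflect_lt lt.2⟩

lemma IsEquivalentTo.of_reindex {L : Type*} [LieRing L] [LieAlgebra ℝ L] {m : ℕ} {r : Row}
    {b : Basis (Fin m) ℝ L} {e : Fin m ≃ Fin n} {e' : Fin r.n ≃ Fin n}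
    (h : IsEquivalentTo (b.reindex e) r e') : IsEquivalentTo b r (e'.trans e.symm) := by
  obtain ⟨c, hc⟩ := h
  have reindex_eq : b.reindex (e'.trans e.symm).symm = (b.reindex e).reindex e'.symm :=
    Basis.eq_of_apply_eq fun i => by simp
  exact ⟨c, reindex_eq ▸ hc⟩

theorem exists_isEquivalentTo {L : Type*} [LieRing L] [LieAlgebra ℝ L] [LieRing.IsNilpotent L]
    {b : Basis (Fin n) ℝ L} (h2 : 2 ≤ n) (h6 : n ≤ 6) (hb : IsNice b) (hirr : IsIrreducible b) :
    ∃ r ∈ table, ∃ e : Fin r.n ≃ Fin n, IsEquivalentTo b r e := by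
  classical
  obtain ⟨e₁, triangular⟩ := exists_isTriangular_reindex hb
  have rescaling := IsRescaling.reindex b e₁.symm
  have lie := isLieTensor_lieCoeff (b.reindex e₁)
  have nice := isNice_iff.1 (rescaling.isNice_iff.2 hb)
  obtain ⟨l, hl, arrows_eq⟩ :=
    exists_mem_diagrams_toFinset_eq lie.toIsAlternatingTensor nice triangular
  have connected := (isIrreducible_iff_isConnectedDiagram arrows_eq).1
    (rescaling.isIrreducible_iff.2 hirr)
  have mem_l {a : Arrow (Fin n)} : a ∈ l ↔ a ∈ arrows (lieCoeff (b.reindex e₁)) := by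
    rw [← arrows_eq, List.mem_toFinset]
  obtain ⟨r, hr, hn, -, p, -, iso⟩ := ((diagrams_classified n (by simp; omega) l hl).resolve_left
    (not_not.2 connected)).resolve_left (not_hasJacobiObstruction lie nice arrows_eq)
  obtain ⟨e₂, he₂⟩ := iso.exists_equiv hn
    (fun a ha => (mem_arrows.1 (mem_l.1 ha)).1) fun a ha => (Row.of_mem_arrowList r hr a ha).1
  obtain ⟨r', hr', e₃, h⟩ := exists_isEquivalentTo_of_lieCoeff_ne_zero_iff hr
    (b := (b.reindex e₁).reindex e₂.symm) fun i j k => by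
      rw [(IsRescaling.reindex _ e₂).lieCoeff_ne_zero_iff, ← lie.sorted_mem_arrows, ← mem_l, he₂,
        ← Row.mem_arrows_structConst hr, r.isAlternatingTensor_structConst.sorted_mem_arrows]
  exact ⟨r', hr', _, h.of_reindex.of_reindex⟩

end Classification

end NiceNilsoliton

open NiceNilsoliton Module in
theorem mainTheorem4 :
    -- every row of the table is a Lie algebra
    (∀ r ∈ table, ∃ (L : Type) (_ : LieRing L) (_ : LieAlgebra ℝ L) (b : Basis (Fin r.n) ℝ L),
      HasStructure r b) ∧
    -- every nice Lie algebra equivalent to a row is irreducible, nice and nilpotent, and has the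
    -- listed Nikolayevsky derivation and set of signatures
    (∀ r ∈ table, ∀ (L : Type*) [LieRing L] [LieAlgebra ℝ L] (n : ℕ) (b : Basis (Fin n) ℝ L)
      (e : Fin r.n ≃ Fin n), IsEquivalentTo b r e →
        IsNice b ∧ LieRing.IsNilpotent L ∧ IsIrreducible b ∧
        IsDiagonalNikolayevsky b (fun i => r.nik (e.symm i)) ∧
        signatures b = (fun s => s.map e.toEmbedding) '' r.sigSet) ∧
    -- every irreducible nice nilpotent Lie algebra of dimension 2, ..., 6 is in the table
    (∀ (L : Type*) [LieRing L] [LieAlgebra ℝ L] (n : ℕ) (b : Basis (Fin n) ℝ L),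
      2 ≤ n → n ≤ 6 → IsNice b → LieRing.IsNilpotent L → IsIrreducible b →
        ∃ r ∈ table, ∃ e : Fin r.n ≃ Fin n, IsEquivalentTo b r e) := by
  refine ⟨fun r hr => Row.exists_hasStructure hr, fun r hr L _ _ n b e ⟨c, hc⟩ => ?_,
    fun L _ _ n b h2 h6 hb _ hirr => exists_isEquivalentTo h2 h6 hb hirr⟩
  have rescaling := IsRescaling.unitsSMul_reindex b e c
  refine ⟨rescaling.isNice_iff.1 (isNice_iff.2 (hc.isNiceTensor hr)),
    (hc.isTriangular hr).isNilpotent, rescaling.isIrreducible_iff.1 (hc.isIrreducible hr),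
    (rescaling.isDiagonalNikolayevsky_iff _).1 ?_, ?_⟩
  · simpa [Function.comp_def] using hc.isDiagonalNikolayevsky hr
  · rw [rescaling.signatures_eq_image, hc.signatures_eq hr]
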